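/- Fix a finite schema $\Sigma$ of extensional relation symbols with arities, an infinite supply of intensional relation symbols of every arity, a countably infinite set of variables, and the domain of constants $\mathbf{Dom}=\mathbb{N}$. A \emph{fact} is an expression $R(a_1,\dots,a_k)$ with $R\in\Sigma$ of arity $k$ and $a_i\in\mathbf{Dom}$; an \emph{instance} is a finite set of facts. A \emph{semi-positive datalog program} $P$ is a finite sequence of rules $S(\bar x)\;{:}{-}\;\alpha_1,\dots,\alpha_n$, where $S$ is intensional, $\bar x$ is a tuple of variables, and each $\alpha_i$ is an extensional or intensional atom, an equality $s=t$, a negated extensional atom, or an inequality $s\neq t$ (terms being variables or constants), together with a designated intensional answer predicate. Every intensional symbol in a body occurs in the head of some rule, and every variable of a rule, including those of its head, occurs in a positive literal (an atom or an equality) of its body. For an instance $\mathbf I$, $P(\mathbf I)$ is the answer relation in the least model of the rules of $P$ over $\mathbf I$, where variables range over $\mathbf{Dom}$. An \emph{update} for $\mathbf I$ is a pair $\mathsf U=(\mathsf{Ins},\mathsf{Del})$ of finite sets of facts with $\mathsf{Ins}\cap\mathbf I=\emptyset$ and $\mathsf{Del}\subseteq\mathbf I$; its size is $|\mathsf{Ins}\cup\mathsf{Del}|$,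 and $\mathbf I_{\mathsf U}=(\mathbf I\cup\mathsf{Ins})\setminus\mathsf{Del}$. It is a \emph{repair} with respect to $\langle P,\mathbf I,\bar a\rangle$ if $\bar a\in P(\mathbf I_{\mathsf U})$. Then for every fixed semi-positive datalog program $P$, the problem $\mathrm{MA}^{P}_{\min}$ is solvable in polynomial time (data complexity): there is a deterministic Turing machine that, given an instance $\mathbf I$ (as a list of its facts in any order, constants written in binary) and a tuple $\bar a$ over $\mathbf{Dom}$ whose length is the arity of $P$, outputs, within a number of steps polynomial in the length of the input, a repair of minimum size with respect to $\langle P,\mathbf I,\bar a\rangle$, or reports that no repair exists. -/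

import Mathlib

namespace SPDatalog

/-! ### Schemas, facts and instances -/

/-- A finite schema of extensional relation symbols (EDBs), each with an arity. -/
structure Schema where
  /-- the extensional relation symbols -/
  Rel : Type
  [fintypeRel : Fintype Rel]
  [decEqRel : DecidableEq Rel]
  /-- the arity of each extensional relation symbol -/
  arity : Rel → ℕ

attribute [instance] Schema.fintypeRel Schema.decEqRel

/-- The countably infinite domain of constants. -/
abbrev Dom : Type := ℕ

/-- The countably infinite set of variables. -/
abbrev Var : Type := ℕ

/-- Intensional relation symbols (IDBs): infinitely many of every arity. -/
structure IDB where
  /-- the arity of the symbol -/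
  arity : ℕ
  /-- the name that tells apart symbols of the same arity -/
  name : ℕ

/-- A fact `R(a₁, …, aₖ)`: an extensional symbol with a tuple of constants of its arity. -/
abbrev Fact (σ : Schema) : Type := Σ R : σ.Rel, (Fin (σ.arity R) → Dom)

/-- A database instance is a finite set of facts. -/
abbrev Instance (σ : Schema) : Type := Finset (Fact σ)

/-! ### Rules and programs -/

/-- A term is a variable or a constant. -/
inductive Term where
  | var (x : Var)
  | const (c : Dom)

/-- The variables that occur in a term. -/
def Term.vars : Term → Set Var
  | .var x => {x}
  | .const _ => ∅

/-- The value of a term under an assignment. -/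
def Term.val (g : Var → Dom) : Term → Dom
  | .var x => g x
  | .const c => c

/-- The literals allowed in the body of a semi-positive rule: extensional and intensional atoms,
equalities, negated extensional atoms, and inequalities. -/
inductive Literal (σ : Schema) where
  | edb (R : σ.Rel) (t : Fin (σ.arity R) → Term)
  | idb (S : IDB) (t : Fin S.arity → Term)
  | eq (s t : Term)
  | notEdb (R : σ.Rel) (t : Fin (σ.arity R) → Term)
  | ne (s t : Term)

/-- The variables that occur in a literal. -/
def Literal.vars {σ : Schema} : Literal σ → Set Var
  | .edb _ t => ⋃ i, (t i).vars
  | .idb _ t => ⋃ i, (t i).vars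
  | .eq s t => s.vars ∪ t.vars
  | .notEdb _ t => ⋃ i, (t i).vars
  | .ne s t => s.vars ∪ t.vars

/-- Positive literals are atoms: extensional atoms, intensional atoms and equalities. -/
def Literal.IsPositive {σ : Schema} : Literal σ → Prop
  | .edb _ _ => True
  | .idb _ _ => True
  | .eq _ _ => True
  | .notEdb _ _ => False
  | .ne _ _ => False

/-- A semi-positive rule `S(x̄) :- α₁, …, αₙ`, whose head is a tuple of variables. -/
structure Rule (σ : Schema) where
  /-- the intensional symbol in the head -/
  headRel : IDB
  /-- the tuple of variables in the head -/
  headVars : Fin headRel.arity → Var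
  /-- the literals of the body -/
  body : List (Literal σ)

/-- The variables that occur in a rule, in the head or in the body. -/
def Rule.vars {σ : Schema} (r : Rule σ) : Set Var :=
  Set.range r.headVars ∪ {x | ∃ l ∈ r.body, x ∈ l.vars}

/-- A semi-positive datalog program. -/
structure Program (σ : Schema) where
  /-- the finite sequence of rules -/
  rules : List (Rule σ)
  /-- the designated answer predicate -/
  ans : IDB
  /-- every intensional symbol in the body of a rule occurs in the head of some rule -/
  idb_defined : ∀ r ∈ rules, ∀ S t, Literal.idb S t ∈ r.body → ∃ r' ∈ rules, r'.headRel = S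
  /-- safety: every variable of a rule (head variables included) occurs in a positive literal
  of its body -/
  safe : ∀ r ∈ rules, ∀ x ∈ r.vars, ∃ l ∈ r.body, l.IsPositive ∧ x ∈ l.vars

/-- The arity of a program is the arity of its answer predicate. -/
abbrev Program.arity {σ : Schema} (P : Program σ) : ℕ := P.ans.arity

/-! ### Semantics -/

/-- An interpretation of all intensional symbols by relations over the domain. -/
abbrev IDBInterp : Type := (S : IDB) → (Fin S.arity → Dom) → Prop

/-- Truth of a literal in an instance, given relations for the intensional symbols and an
assignment. -/
def Literal.Holds {σ : Schema} (I : Instance σ) (X : IDBInterp) (g : Var → Dom) :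
    Literal σ → Prop
  | .edb R t => (⟨R, fun i => (t i).val g⟩ : Fact σ) ∈ I
  | .idb S t => X S (fun i => (t i).val g)
  | .eq s t => s.val g = t.val g
  | .notEdb R t => (⟨R, fun i => (t i).val g⟩ : Fact σ) ∉ I
  | .ne s t => s.val g ≠ t.val g

/-- `X` is closed under all rules of `P` over the instance `I`. -/
def Program.IsModel {σ : Schema} (P : Program σ) (I : Instance σ) (X : IDBInterp) : Prop :=
  ∀ r ∈ P.rules, ∀ g : Var → Dom,
    (∀ l ∈ r.body, l.Holds I X g) → X r.headRel (fun i => g (r.headVars i))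

/-- The answer `P(I)`: the answer relation in the least model of `P` over `I`. -/
def Program.answer {σ : Schema} (P : Program σ) (I : Instance σ) : Set (Fin P.arity → Dom) :=
  {a | ∀ X : IDBInterp, P.IsModel I X → X P.ans a}

/-! ### Updates and repairs -/

/-- A pair `(Ins, Del)` of finite sets of facts. -/
structure Update (σ : Schema) where
  /-- the facts to be inserted -/
  ins : Finset (Fact σ)
  /-- the facts to be deleted -/
  del : Finset (Fact σ)

/-- `U` is an update for `I`: it inserts facts not in `I` and deletes facts of `I`. -/
def Update.IsUpdateFor {σ : Schema} (U : Update σ) (I : Instance σ) : Prop :=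
  (∀ f ∈ U.ins, f ∉ I) ∧ U.del ⊆ I

/-- The updated instance `I_U = (I ∪ Ins) \ Del`. -/
def Update.apply {σ : Schema} (U : Update σ) (I : Instance σ) : Instance σ :=
  (I ∪ U.ins) \ U.del

/-- The size `|Ins ∪ Del|` of an update. -/
def Update.size {σ : Schema} (U : Update σ) : ℕ := (U.ins ∪ U.del).card

/-- `U` is a repair with respect to `⟨P, I, a⟩`. -/
def Program.IsRepair {σ : Schema} (P : Program σ) (I : Instance σ) (a : Fin P.arity → Dom)
    (U : Update σ) : Prop :=
  U.IsUpdateFor I ∧ a ∈ P.answer (U.apply I)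

/-- `U` is a repair of minimum cardinality with respect to `⟨P, I, a⟩`. -/
def Program.IsMinRepair {σ : Schema} (P : Program σ) (I : Instance σ) (a : Fin P.arity → Dom)
    (U : Update σ) : Prop :=
  P.IsRepair I a U ∧ ∀ U' : Update σ, P.IsRepair I a U' → U.size ≤ U'.size

/-- Correct outputs of the missing answer repair problem on the input `⟨I, a⟩`: a repair of minimum
cardinality, or the indication `none` that there is no repair. -/
def Program.IsMAMinOutput {σ : Schema} (P : Program σ) (I : Instance σ) (a : Fin P.arity → Dom) :
    Option (Update σ) → Prop
  | none => ∀ U : Update σ, ¬ P.IsRepair I a U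
  | some U => P.IsMinRepair I a U

/-! ### Encodings as strings over a finite alphabet -/

/-- The letters of inputs and outputs: bits, an end marker for constants, one letter for each
extensional relation symbol, and a separator. -/
inductive Letter (σ : Schema) where
  | bit (b : Bool)
  | endConst
  | rel (R : σ.Rel)
  | sep

/-- A constant is written in binary, followed by an end marker. -/
def encodeConst (σ : Schema) (c : Dom) : List (Letter σ) :=
  (Computability.encodeNat c).map Letter.bit ++ [Letter.endConst]

/-- A tuple is written as the sequence of its constants. -/
def encodeTuple (σ : Schema) {k : ℕ} (a : Fin k → Dom) : List (Letter σ) :=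
  (List.ofFn a).flatMap (encodeConst σ)

/-- A fact is written as its relation symbol followed by its tuple of constants. -/
def encodeFact {σ : Schema} (f : Fact σ) : List (Letter σ) :=
  Letter.rel f.1 :: encodeTuple σ f.2

/-- A list of facts is written as the concatenation of its facts. -/
def encodeFacts {σ : Schema} (L : List (Fact σ)) : List (Letter σ) :=
  L.flatMap encodeFact

/-- An input `⟨I, a⟩`, where `I` is given by a listing of its facts. -/
def encodeInput {σ : Schema} {k : ℕ} (x : List (Fact σ) × (Fin k → Dom)) : List (Letter σ) :=
  encodeFacts x.1 ++ Letter.sep :: encodeTuple σ x.2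

/-- An output: listings of the facts to be inserted and of those to be deleted, or the empty
string, which indicates that there is no repair. -/
def encodeOutput {σ : Schema} : Option (List (Fact σ) × List (Fact σ)) → List (Letter σ)
  | none => []
  | some y => encodeFacts y.1 ++ Letter.sep :: encodeFacts y.2

/-- The update given by a listing of its insertions and a listing of its deletions. -/
def Update.ofLists {σ : Schema} (y : List (Fact σ) × List (Fact σ)) : Update σ :=
  ⟨y.1.toFinset, y.2.toFinset⟩

/-- `f` is computed by a (multi-stack) Turing machine in time polynomial in the length of the
encoded input. -/
def PolyTimeComputable {α β Γ₀ Γ₁ : Type} (ea : α → List Γ₀) (eb : β → List Γ₁) (f : α → β) :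
    Prop :=
  Nonempty (Turing.TM2ComputableInPolyTime ea eb f)

end SPDatalog

/-!
The theorem rests on two observations about a fixed program `P`.

*Small repairs.* A derivation of an answer uses finitely many facts positively and finitely many
negatively (`Program.exists_support`). Up to renamings of constants that fix those of `P`, there are
finitely many tuples of the arity of `P`, so a single bound `K` works for all tuples that are
answers over some instance (`Program.exists_support_card_le`); inserting the positive facts and
deleting the negative ones turns every instance into one that has the answer. Hence, if there is a
repair at all, there is one of size at most `K`. By another renaming, a minimum repair can be
assumed to have constants that occur in the instance, in the tuple, in `P`, or among a bounded
number of fresh constants. So it is found among polynomially many candidates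
(`Program.exists_mem_solutions`), which are tried in order of increasing size.

*Evaluation.* To test a candidate, the immediate consequence operator is iterated over a finite
domain. Rules such as `S(x) :- x = x` let variables range over all constants, but the constants of a
rule instance can be moved into the domain if it has enough elements that occur neither in the
instance nor in the program (`Program.mem_eval_of_mem_answer`).

For the running time, programs of a small structured language for stack machines are compiled to
`Turing.TM2`, step by step (`Cmd.Run.iterate_step`). All data are binary trees in prefix notation on
one stack, and `PT f` says that a program replaces the code of `a` on top of this stack by the code
of `f a` in polynomial time. Such functions are closed under composition, pairing, case
distinctions, and iterations along a list in which a step enlarges the state by a polynomially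
bounded amount (`PT.foldl`). The search is built from these operations (`PT.solve`).
-/

namespace SPDatalog

open Polynomial

/-! ### A structured language for stack machines -/

/-- Structured programs over stacks indexed by `K` that hold symbols of `Γ`. -/
inductive Cmd (K Γ : Type) where
  | skip
  | push (k : K) (s : Γ)
  | pop (k : K)
  | seq (c d : Cmd K Γ)
  /-- run the program selected by the top symbol of the stack `k` (`none` if `k` is empty) -/
  | branch (k : K) (f : Option Γ → Cmd K Γ)
  /-- run `c` as long as the top symbol of the stack `k` satisfies `p` -/
  | loop (k : K) (p : Option Γ → Bool) (c : Cmd K Γ)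

namespace Cmd

variable {K Γ : Type}

/-- `Run c S t S'`: started on the stacks `S`, the program `c` stops with the stacks `S'` after
exactly `t` steps. -/
inductive Run [DecidableEq K] : Cmd K Γ → (K → List Γ) → ℕ → (K → List Γ) → Prop
  | skip {S} : Run skip S 1 S
  | push {S k s} : Run (push k s) S 1 (Function.update S k (s :: S k))
  | pop {S k} : Run (pop k) S 1 (Function.update S k (S k).tail)
  | seq {c d S t S' t' S''} (h : Run c S t S') (h' : Run d S' t' S'') :
      Run (seq c d) S (t + t') S''
  | branch {k f S t S'} (h : Run (f (S k).head?) S t S') : Run (branch k f) S (t + 1) S'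
  | finish {k p c S} (hp : p (S k).head? = false) : Run (loop k p c) S 1 S
  | step {k p c S t S' t' S''} (hp : p (S k).head? = true) (h : Run c S t S')
      (h' : Run (loop k p c) S' t' S'') : Run (loop k p c) S (t + t' + 1) S''

/-- The labels of the code compiled from a program. -/
def Label : Cmd K Γ → Type
  | skip => Unit
  | push _ _ => Unit
  | pop _ => Unit
  | seq c d => c.Label ⊕ d.Label
  | branch _ f => Option (Σ o, (f o).Label)
  | loop _ _ c => Option c.Label

instance finiteLabel [Finite Γ] : (c : Cmd K Γ) → Finite c.Label
  | skip => inferInstanceAs (Finite Unit)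
  | push _ _ => inferInstanceAs (Finite Unit)
  | pop _ => inferInstanceAs (Finite Unit)
  | seq c d =>
    have := finiteLabel c
    have := finiteLabel d
    inferInstanceAs (Finite (c.Label ⊕ d.Label))
  | branch _ f =>
    have := fun o => finiteLabel (f o)
    inferInstanceAs (Finite (Option (Σ o, (f o).Label)))
  | loop _ _ c =>
    have := finiteLabel c
    inferInstanceAs (Finite (Option c.Label))

/-- The label at which the code of a program starts. -/
def entry : (c : Cmd K Γ) → c.Label
  | skip => ()
  | push _ _ => ()
  | pop _ => ()
  | seq c _ => .inl c.entry
  | branch _ _ => none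
  | loop _ _ _ => none

/-- The code of a program, in a machine whose labels contain those of the program by `e`, and
which continues at the label `x` when the program stops. The internal state of the machine holds
the symbol read last. -/
def code {Λ : Type} : (c : Cmd K Γ) → (e : c.Label → Λ) → (x : Λ) → c.Label →
    Turing.TM2.Stmt (fun _ : K => Γ) Λ (Option Γ)
  | skip, _, x, _ => .goto fun _ => x
  | push k s, _, x, _ => .push k (fun _ => s) (.goto fun _ => x)
  | pop k, _, x, _ => .pop k (fun v _ => v) (.goto fun _ => x)
  | seq c d, e, _, .inl l => c.code (fun l => e (.inl l)) (e (.inr d.entry)) l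
  | seq _ d, e, x, .inr l => d.code (fun l => e (.inr l)) x l
  | branch k f, e, _, none => .peek k (fun _ o => o) (.goto fun v => e (some ⟨v, (f v).entry⟩))
  | branch _ f, e, x, some l => (f l.1).code (fun l' => e (some ⟨l.1, l'⟩)) x l.2
  | loop k p c, e, x, none =>
    .peek k (fun _ o => o) (.branch p (.goto fun _ => e (some c.entry)) (.goto fun _ => x))
  | loop _ _ c, e, _, some l => c.code (fun l => e (some l)) (e none) l

variable [DecidableEq K]

/-- The code of a program runs as the program does, step by step. -/
theorem Run.iterate_step {c : Cmd K Γ} {S S' : K → List Γ} {t : ℕ} (h : c.Run S t S')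
    {Λ : Type} (M : Λ → Turing.TM2.Stmt (fun _ : K => Γ) Λ (Option Γ)) (e : c.Label → Λ) (x : Λ)
    (hM : ∀ l, M (e l) = c.code e x l) (v : Option Γ) :
    ∃ v', (flip bind (Turing.TM2.step M))^[t] (some ⟨some (e c.entry), v, S⟩) =
      some ⟨some x, v', S'⟩ := by
  have one : ∀ (l : Λ) (v : Option Γ) (S : K → List Γ),
      flip bind (Turing.TM2.step M) (some ⟨some l, v, S⟩) =
        some (Turing.TM2.stepAux (M l) v S) := fun _ _ _ => rfl
  induction h generalizing v x with
  | skip => exact ⟨v, by rw [Function.iterate_one, one, hM]; rfl⟩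
  | push => exact ⟨v, by rw [Function.iterate_one, one, hM]; rfl⟩
  | pop => exact ⟨v, by rw [Function.iterate_one, one, hM]; rfl⟩
  | @seq c d S t S' t' S'' _ _ ih ih' =>
    obtain ⟨v₁, h₁⟩ := ih (fun l => e (.inl l)) (e (.inr d.entry)) (fun l => hM (.inl l)) v
    obtain ⟨v₂, h₂⟩ := ih' (fun l => e (.inr l)) x (fun l => hM (.inr l)) v₁
    refine ⟨v₂, ?_⟩
    rw [add_comm, Function.iterate_add_apply]
    exact (congrArg _ h₁).trans h₂
  | @branch k f S t S' _ ih =>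
    obtain ⟨v₁, h₁⟩ := ih (fun l' => e (some ⟨_, l'⟩)) x (fun l => hM (some ⟨_, l⟩)) (S k).head?
    refine ⟨v₁, ?_⟩
    rw [Function.iterate_succ_apply]
    refine Eq.trans (congrArg _ ?_) h₁
    rw [one, hM]; rfl
  | @finish k p c S hp => 
    refine ⟨(S k).head?, ?_⟩
    rw [Function.iterate_one, one, hM]
    simp [entry, code, hp]
  | @step k p c S t S' t' S'' hp _ _ ih ih' =>
    obtain ⟨v₁, h₁⟩ := ih (fun l => e (some l)) (e none) (fun l => hM (some l)) (S k).head?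
    obtain ⟨v₂, h₂⟩ := ih' e x hM v₁
    refine ⟨v₂, ?_⟩
    rw [Function.iterate_succ_apply, add_comm, Function.iterate_add_apply]
    refine Eq.trans (congrArg _ ?_) h₂
    refine Eq.trans (congrArg _ ?_) h₁
    rw [one, hM]
    simp [entry, code, hp]

/-- A step of a program adds at most one symbol to the stacks. -/
theorem Run.sum_length_le [Fintype K] {c : Cmd K Γ} {S S' : K → List Γ} {t : ℕ}
    (h : c.Run S t S') : ∑ k, (S' k).length ≤ ∑ k, (S k).length + t := by
  induction h with
  | skip => simp
  | @push S k s =>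
    rw [← Finset.add_sum_erase _ _ (Finset.mem_univ k),
      ← Finset.add_sum_erase (a := k) _ (fun k => (S k).length) (Finset.mem_univ k),
      Finset.sum_congr rfl (g := fun k => (S k).length)]
    · simp; omega
    · intro j hj
      simp [Function.update_of_ne (Finset.ne_of_mem_erase hj)]
  | @pop S k =>
    refine le_trans (Finset.sum_le_sum fun j _ => ?_) (Nat.le_add_right _ _)
    by_cases hj : j = k
    · subst hj; simp
    · simp [Function.update_of_ne hj]
  | seq _ _ ih ih' => omega
  | branch _ ih => omega
  | finish => simp
  | step _ _ _ ih ih' => omega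

end Cmd

/-! ### Binary trees on a stack -/

/-- Binary trees, the data on which all intermediate computations operate. -/
inductive BTree where
  | nil
  | node (l r : BTree)

namespace BTree

/-- A tree in prefix notation: `endConst` stands for an inner node and `sep` for a leaf. -/
def word (σ : Schema) : BTree → List (Letter σ)
  | nil => [.sep]
  | node l r => .endConst :: (l.word σ ++ r.word σ)

/-- The number of nodes of a tree, leaves included. -/
def size : BTree → ℕ
  | nil => 1
  | node l r => l.size + r.size + 1

variable {σ : Schema}

@[simp] theorem length_word (t : BTree) : (t.word σ).length = t.size := by
  induction t with
  | nil => rfl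
  | node l r ihl ihr => simp [word, size, ihl, ihr]

/-- Prefix notation is a prefix code. -/
theorem word_append_inj {t u : BTree} {v w : List (Letter σ)}
    (h : t.word σ ++ v = u.word σ ++ w) : t = u ∧ v = w := by
  induction t generalizing u v w with
  | nil => cases u <;> simp_all [word]
  | node l r ihl ihr =>
    cases u with
    | nil => simp [word] at h
    | node l' r' =>
      simp only [word, List.cons_append, List.append_assoc, List.cons.injEq, true_and] at h
      obtain ⟨hl, h'⟩ := ihl h
      obtain ⟨hr, hv⟩ := ihr h'
      exact ⟨by rw [hl, hr], hv⟩

theorem word_injective : Function.Injective (word σ) := fun t u h =>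
  (word_append_inj (v := []) (w := []) (by rw [h])).1

end BTree

/-- The stacks of the machine: the main stack holds the data, `cnt` a counter, and the other two
are used for moving data around. The input is given on `aux` and the output delivered on `out`. -/
inductive Reg where
  | main
  | aux
  | out
  | cnt
  deriving DecidableEq

instance : Fintype Reg where
  elems := {.main, .aux, .out, .cnt}
  complete k := by cases k <;> simp

/-- Programs over these stacks. -/
abbrev Prog (σ : Schema) : Type := Cmd Reg (Letter σ)

section

variable {σ : Schema}

/-- The contents of the four stacks. -/
def regs (m a o c : List (Letter σ)) : Reg → List (Letter σ)
  | .main => m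
  | .aux => a
  | .out => o
  | .cnt => c

section

variable (m a o c l : List (Letter σ))

@[simp] theorem regs_main : regs m a o c .main = m := rfl
@[simp] theorem regs_aux : regs m a o c .aux = a := rfl
@[simp] theorem regs_out : regs m a o c .out = o := rfl
@[simp] theorem regs_cnt : regs m a o c .cnt = c := rfl

@[simp] theorem update_regs_main :
    Function.update (regs m a o c) .main l = regs l a o c := by
  funext k; cases k <;> simp

@[simp] theorem update_regs_aux :
    Function.update (regs m a o c) .aux l = regs m l o c := by
  funext k; cases k <;> simp

@[simp] theorem update_regs_out :
    Function.update (regs m a o c) .out l = regs m a l c := by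
  funext k; cases k <;> simp

@[simp] theorem update_regs_cnt :
    Function.update (regs m a o c) .cnt l = regs m a o l := by
  funext k; cases k <;> simp

end

namespace Cmd

variable {m a o c : List (Letter σ)} {s : Letter σ}

/-- `c.Within S S' n`: the program `c` leads from the stacks `S` to `S'` in at most `n` steps. -/
def Within (p : Prog σ) (S S' : Reg → List (Letter σ)) (n : ℕ) : Prop :=
  ∃ t ≤ n, p.Run S t S'

variable {p q : Prog σ} {S S' S'' : Reg → List (Letter σ)} {n n' : ℕ} {k : Reg}

theorem Within.mono (h : p.Within S S' n) (hn : n ≤ n') : p.Within S S' n' :=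
  let ⟨t, ht, hr⟩ := h
  ⟨t, ht.trans hn, hr⟩

theorem Within.seq (h : p.Within S S' n) (h' : q.Within S' S'' n') :
    (p.seq q).Within S S'' (n + n') :=
  let ⟨_, ht, hr⟩ := h
  let ⟨_, ht', hr'⟩ := h'
  ⟨_, add_le_add ht ht', .seq hr hr'⟩

theorem Within.push : (Cmd.push k s).Within S (Function.update S k (s :: S k)) 1 :=
  ⟨1, le_rfl, .push⟩

theorem Within.pop : (Cmd.pop k).Within S (Function.update S k (S k).tail) 1 :=
  ⟨1, le_rfl, .pop⟩

theorem Within.skip : (Cmd.skip : Prog σ).Within S S 1 :=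
  ⟨1, le_rfl, .skip⟩

theorem Within.branch {f : Option (Letter σ) → Prog σ} (h : (f (S k).head?).Within S S' n) :
    (Cmd.branch k f).Within S S' (n + 1) :=
  let ⟨_, ht, hr⟩ := h
  ⟨_, Nat.succ_le_succ ht, .branch hr⟩

theorem Within.finish {b : Option (Letter σ) → Bool} (hb : b (S k).head? = false) :
    (Cmd.loop k b p).Within S S 1 :=
  ⟨1, le_rfl, .finish hb⟩

theorem Within.step {b : Option (Letter σ) → Bool} (hb : b (S k).head? = true)
    (h : p.Within S S' n) (h' : (Cmd.loop k b p).Within S' S'' n') :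
    (Cmd.loop k b p).Within S S'' (n + n' + 1) :=
  let ⟨_, ht, hr⟩ := h
  let ⟨_, ht', hr'⟩ := h'
  ⟨_, Nat.succ_le_succ (add_le_add ht ht'), .step hb hr hr'⟩

theorem Within.push_main : (Cmd.push .main s).Within (regs m a o c) (regs (s :: m) a o c) 1 := by
  simpa using Within.push (S := regs m a o c) (k := .main) (s := s)

theorem Within.push_aux : (Cmd.push .aux s).Within (regs m a o c) (regs m (s :: a) o c) 1 := by
  simpa using Within.push (S := regs m a o c) (k := .aux) (s := s)

theorem Within.push_out : (Cmd.push .out s).Within (regs m a o c) (regs m a (s :: o) c) 1 := by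
  simpa using Within.push (S := regs m a o c) (k := .out) (s := s)

theorem Within.push_cnt : (Cmd.push .cnt s).Within (regs m a o c) (regs m a o (s :: c)) 1 := by
  simpa using Within.push (S := regs m a o c) (k := .cnt) (s := s)

theorem Within.pop_main : (Cmd.pop .main).Within (regs m a o c) (regs m.tail a o c) 1 := by
  simpa using Within.pop (S := regs m a o c) (k := .main)

theorem Within.pop_out : (Cmd.pop .out).Within (regs m a o c) (regs m a o.tail c) 1 := by
  simpa using Within.pop (S := regs m a o c) (k := .out)

/-- Move the symbols of the stack `k` one by one, handling each with `f`. -/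
def forSymbols (k : Reg) (f : Letter σ → Prog σ) : Prog σ :=
  loop k Option.isSome (branch k fun s => (pop k).seq (s.elim skip f))

theorem forSymbols_cons {f : Letter σ → Prog σ} {l : List (Letter σ)} (hk : S k = s :: l)
    (h : (f s).Within (Function.update S k l) S' n) (h' : (forSymbols k f).Within S' S'' n') :
    (forSymbols k f).Within S S'' (n + n' + 3) := by
  refine (Within.step (n := n + 2) (by simp [hk]) (.branch ?_) h').mono (by omega)
  rw [hk, Nat.add_comm n 1]
  refine Within.seq .pop ?_
  simpa [hk] using h

theorem forSymbols_nil {f : Letter σ → Prog σ} (hk : S k = []) :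
    (forSymbols k f).Within S S 1 :=
  Within.finish (by simp [hk])

/-- Empty the stack `aux`, onto the main stack. -/
def auxToMain : Prog σ := forSymbols .aux (push .main)

theorem within_auxToMain :
    (auxToMain (σ := σ)).Within (regs m a o c) (regs (a.reverse ++ m) [] o c)
      (4 * a.length + 1) := by
  induction a generalizing m with
  | nil => exact forSymbols_nil rfl
  | cons s l ih =>
    refine (forSymbols_cons (s := s) (l := l) rfl ?_ ih).mono (n := 1 + (4 * l.length + 1) + 3)
      (by simp; omega) |> fun h => by simpa [auxToMain] using h
    simpa using Within.push_main

/-- Empty the stack `out`, onto the main stack. -/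
def outToMain : Prog σ := forSymbols .out (push .main)

theorem within_outToMain :
    (outToMain (σ := σ)).Within (regs m a o c) (regs (o.reverse ++ m) a [] c)
      (4 * o.length + 1) := by
  induction o generalizing m with
  | nil => exact forSymbols_nil rfl
  | cons s l ih =>
    refine (forSymbols_cons (s := s) (l := l) rfl ?_ ih).mono (n := 1 + (4 * l.length + 1) + 3)
      (by simp; omega) |> fun h => by simpa [outToMain] using h
    simpa using Within.push_main

/-- Empty the stack `out`, onto `aux`. -/
def outToAux : Prog σ := forSymbols .out (push .aux)

theorem within_outToAux :
    (outToAux (σ := σ)).Within (regs m a o c) (regs m (o.reverse ++ a) [] c)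
      (4 * o.length + 1) := by
  induction o generalizing a with
  | nil => exact forSymbols_nil rfl
  | cons s l ih =>
    refine (forSymbols_cons (s := s) (l := l) rfl ?_ ih).mono (n := 1 + (4 * l.length + 1) + 3)
      (by simp; omega) |> fun h => by simpa [outToAux] using h
    simpa using Within.push_aux

/-- Empty the stack `aux`, copying it onto the main stack and onto `out`. -/
def auxToMainOut : Prog σ := forSymbols .aux fun s => (push .main s).seq (push .out s)

theorem within_auxToMainOut :
    (auxToMainOut (σ := σ)).Within (regs m a o c)
      (regs (a.reverse ++ m) [] (a.reverse ++ o) c) (5 * a.length + 1) := by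
  induction a generalizing m o with
  | nil => exact forSymbols_nil rfl
  | cons s l ih =>
    refine (forSymbols_cons (s := s) (l := l) rfl ?_ ih).mono (n := 2 + (5 * l.length + 1) + 3)
      (by simp; omega) |> fun h => by simpa [auxToMainOut] using h
    simpa using Within.push_main.seq Within.push_out

/-- Empty the stack `aux`. -/
def clearAux : Prog σ := forSymbols .aux fun _ => skip

theorem within_clearAux :
    (clearAux (σ := σ)).Within (regs m a o c) (regs m [] o c) (4 * a.length + 1) := by
  induction a with
  | nil => exact forSymbols_nil rfl
  | cons s l ih =>
    refine (forSymbols_cons (s := s) (l := l) rfl ?_ ih).mono (n := 1 + (4 * l.length + 1) + 3)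
      (by simp; omega)
    simpa using Within.skip

/-- Empty the stack `cnt`. -/
def clearCnt : Prog σ := forSymbols .cnt fun _ => skip

theorem within_clearCnt :
    (clearCnt (σ := σ)).Within (regs m a o c) (regs m a o []) (4 * c.length + 1) := by
  induction c with
  | nil => exact forSymbols_nil rfl
  | cons s l ih =>
    refine (forSymbols_cons (s := s) (l := l) rfl ?_ ih).mono (n := 1 + (4 * l.length + 1) + 3)
      (by simp; omega)
    simpa using Within.skip

/-- The stack onto which a tree is moved. -/
def side : Bool → Reg
  | false => .aux
  | true => .out

/-- Move as many trees as the counter says from the main stack to a side stack: an inner node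
replaces one pending tree by two, a leaf completes one. -/
def moveTrees (b : Bool) : Prog σ :=
  forSymbols .cnt fun _ => branch .main fun
    | some .endConst =>
      (push .cnt .sep).seq ((push .cnt .sep).seq ((pop .main).seq (push (side b) .endConst)))
    | _ => (pop .main).seq (push (side b) .sep)

/-- Moving the first tree takes the loop from a counter `s :: c` to the counter `c`. This is stated
for an arbitrary rest of the run, so that it applies to the subtrees of `t` one after the other. -/
theorem within_moveTrees {t : BTree} {b : Bool}
    (h : (moveTrees b).Within (regs m (cond b a ((t.word σ).reverse ++ a))
      (cond b ((t.word σ).reverse ++ o) o) c) S n) :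
    (moveTrees b).Within (regs (t.word σ ++ m) a o (s :: c)) S (n + 8 * t.size) := by
  induction t generalizing m a o s c n with
  | nil =>
    refine (forSymbols_cons (n := 3) (n' := n) (s := s) (l := c)
      rfl (.branch ?_) h).mono (by simp [BTree.size]; omega)
    simp only [update_regs_cnt]
    refine Within.seq (S' := regs m a o c) (n := 1) (n' := 1) Within.pop_main ?_
    cases b
    · exact Within.push_aux
    · exact Within.push_out
  | node l r ihl ihr =>
    have h' := ihl (s := .sep) (c := .sep :: c) (m := r.word σ ++ m)
      (a := cond b a (.endConst :: a)) (o := cond b (.endConst :: o) o) <|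
      ihr (s := .sep) (c := c) (m := m) (n := n) (by cases b <;> simpa [BTree.word] using h)
    refine (forSymbols_cons (n := 5) (s := s) (l := c)
      rfl (.branch ?_) h').mono (by simp [BTree.size]; omega)
    simp only [update_regs_cnt]
    refine Within.seq (n := 1) (n' := 3) Within.push_cnt ?_
    refine Within.seq (n := 1) (n' := 2) Within.push_cnt ?_
    refine Within.seq (n := 1) (n' := 1) Within.pop_main ?_
    cases b
    · simpa [BTree.word, side] using Within.push_aux
    · simpa [BTree.word, side] using Within.push_out

/-- Move a tree from the main stack to a side stack, where its word appears reversed. -/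
def moveTree (b : Bool) : Prog σ := (push .cnt .sep).seq (moveTrees b)

theorem within_moveTree {t : BTree} (b : Bool) :
    (moveTree b).Within (regs (t.word σ ++ m) a o []) (regs m
      (cond b a ((t.word σ).reverse ++ a)) (cond b ((t.word σ).reverse ++ o) o) [])
      (8 * t.size + 2) :=
  (Within.push_cnt.seq (within_moveTrees (forSymbols_nil rfl))).mono (by omega)

/-- Remove the topmost tree. -/
def drop : Prog σ := (moveTree false).seq clearAux

theorem within_drop {t : BTree} :
    (drop (σ := σ)).Within (regs (t.word σ ++ m) [] [] []) (regs m [] [] [])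
      (12 * t.size + 3) :=
  ((within_moveTree false).seq within_clearAux).mono (by simp; omega)

/-- Duplicate the topmost tree. -/
def dup : Prog σ := (moveTree false).seq (auxToMainOut.seq (outToAux.seq auxToMain))

theorem within_dup {t : BTree} :
    (dup (σ := σ)).Within (regs (t.word σ ++ m) [] [] [])
      (regs (t.word σ ++ (t.word σ ++ m)) [] [] []) (21 * t.size + 5) := by
  have h₁ : Within (moveTree false) (regs (t.word σ ++ m) [] [] [])
      (regs m (t.word σ).reverse [] []) (8 * t.size + 2) := by
    simpa using within_moveTree (a := []) (o := []) false
  have h₂ : Within auxToMainOut (regs m (t.word σ).reverse [] [])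
      (regs (t.word σ ++ m) [] (t.word σ) []) (5 * t.size + 1) := by
    simpa using within_auxToMainOut (a := (t.word σ).reverse) (o := [])
  have h₃ : Within outToAux (regs (t.word σ ++ m) [] (t.word σ) [])
      (regs (t.word σ ++ m) (t.word σ).reverse [] []) (4 * t.size + 1) := by
    simpa using within_outToAux (o := t.word σ) (a := [])
  have h₄ : Within auxToMain (regs (t.word σ ++ m) (t.word σ).reverse [] [])
      (regs (t.word σ ++ (t.word σ ++ m)) [] [] []) (4 * t.size + 1) := by
    simpa using within_auxToMain (a := (t.word σ).reverse)
  exact (h₁.seq (h₂.seq (h₃.seq h₄))).mono (by omega)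

/-- Exchange the two topmost trees. -/
def swap : Prog σ := (moveTree false).seq ((moveTree true).seq (auxToMain.seq outToMain))

theorem within_swap {t u : BTree} :
    (swap (σ := σ)).Within (regs (t.word σ ++ (u.word σ ++ m)) [] [] [])
      (regs (u.word σ ++ (t.word σ ++ m)) [] [] []) (12 * (t.size + u.size) + 6) := by
  have h₁ : Within (moveTree false) (regs (t.word σ ++ (u.word σ ++ m)) [] [] [])
      (regs (u.word σ ++ m) (t.word σ).reverse [] []) (8 * t.size + 2) := by
    simpa using within_moveTree (a := []) (o := []) false
  have h₂ : Within (moveTree true) (regs (u.word σ ++ m) (t.word σ).reverse [] [])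
      (regs m (t.word σ).reverse (u.word σ).reverse []) (8 * u.size + 2) := by
    simpa using within_moveTree (a := (t.word σ).reverse) (o := []) true
  have h₃ : Within auxToMain (regs m (t.word σ).reverse (u.word σ).reverse [])
      (regs (t.word σ ++ m) [] (u.word σ).reverse []) (4 * t.size + 1) := by
    simpa using within_auxToMain (a := (t.word σ).reverse)
  have h₄ : Within outToMain (regs (t.word σ ++ m) [] (u.word σ).reverse [])
      (regs (u.word σ ++ (t.word σ ++ m)) [] [] []) (4 * u.size + 1) := by
    simpa using within_outToMain (o := (u.word σ).reverse)
  exact (h₁.seq (h₂.seq (h₃.seq h₄))).mono (by omega)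

open Classical in
/-- Empty `aux` and `out`, recording in the counter whether they differ. -/
noncomputable def compare : Prog σ :=
  (forSymbols .aux fun s =>
    branch .out fun s' => (if s' = some s then skip else push .cnt .sep).seq (pop .out)).seq
  (forSymbols .out fun _ => push .cnt .sep)

/-- In the end, an empty counter says that it was empty before and that the two stacks agreed. -/
theorem within_compare : ∃ c', ((c' = [] ↔ c = [] ∧ a = o) ∧
      c'.length ≤ c.length + (a.length + o.length)) ∧
    (compare (σ := σ)).Within (regs m a o c) (regs m [] [] c')
      (6 * (a.length + o.length) + 2) := by
  classical
  suffices h : ∃ c₁ o₁, ((c₁ = [] ∧ o₁ = [] ↔ c = [] ∧ a = o) ∧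
      c₁.length + o₁.length ≤ c.length + (a.length + o.length) ∧ o₁.length ≤ o.length) ∧
      (forSymbols .aux fun s => branch .out fun s' =>
        (if s' = some s then skip else push .cnt .sep).seq (pop .out) : Prog σ).Within
        (regs m a o c) (regs m [] o₁ c₁) (6 * a.length + 1) by
    obtain ⟨c₁, o₁, ⟨h₁, h₂, h₃⟩, h₄⟩ := h
    have h₅ : ∀ c₂ : List (Letter σ), ∃ c₃ : List (Letter σ), ((c₃ = [] ↔ c₂ = [] ∧ o₁ = []) ∧
        c₃.length ≤ c₂.length + o₁.length) ∧
        (forSymbols .out fun _ => push .cnt .sep : Prog σ).Within (regs m [] o₁ c₂)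
          (regs m [] [] c₃) (4 * o₁.length + 1) := by
      clear h₁ h₂ h₃ h₄
      induction o₁ with
      | nil => exact fun c₂ => ⟨c₂, by simp, forSymbols_nil rfl⟩
      | cons s l ih =>
        intro c₂
        obtain ⟨c₃, ⟨h, h'⟩, h''⟩ := ih (.sep :: c₂)
        refine ⟨c₃, ⟨by simp [h], by simp at h' ⊢; omega⟩,
          (forSymbols_cons (n := 1) (s := s) (l := l) rfl ?_ h'').mono (by simp; omega)⟩
        simpa using Within.push_cnt
    obtain ⟨c₃, ⟨h₆, h₇⟩, h₈⟩ := h₅ c₁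
    exact ⟨c₃, ⟨by rw [h₆, h₁], by omega⟩, (h₄.seq h₈).mono (by omega)⟩
  induction a generalizing o c with
  | nil => exact ⟨c, o, ⟨by simp [eq_comm], by simp⟩, forSymbols_nil rfl⟩
  | cons s l ih =>
    by_cases ho : o.head? = some s
    · obtain ⟨o', rfl⟩ : ∃ o', o = s :: o' := by
        cases o with
        | nil => simp at ho
        | cons x y => simp at ho; exact ⟨y, by rw [ho]⟩
      obtain ⟨c₁, o₁, ⟨h₁, h₂, h₃⟩, h₄⟩ := ih (o := o') (c := c)
      refine ⟨c₁, o₁, ⟨by simpa using h₁, by simp; omega, by simp; omega⟩,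
        (forSymbols_cons (n := 3) (s := s) (l := l) rfl (.branch ?_) h₄).mono (by simp; omega)⟩
      simpa using Within.seq Within.skip (Within.pop_out (m := m) (a := l) (o := s :: o') (c := c))
    · obtain ⟨c₁, o₁, ⟨h₁, h₂, h₃⟩, h₄⟩ := ih (o := o.tail) (c := .sep :: c)
      have : o.tail.length ≤ o.length := by simp
      refine ⟨c₁, o₁, ⟨?_, by simp at h₂ ⊢; omega, by omega⟩,
        (forSymbols_cons (n := 3) (s := s) (l := l) rfl (.branch ?_) h₄).mono (by simp; omega)⟩
      · rw [h₁]
        constructor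
        · simp
        · rintro ⟨-, rfl⟩
          simp at ho
      · simp only [update_regs_aux, regs_out, if_neg ho]
        exact Within.push_cnt.seq Within.pop_out

end Cmd

end

/-! ### Functions computable in polynomial time on encoded data -/

/-- Types whose elements are encoded as binary trees. -/
class Coded (α : Type) where
  /-- the tree that encodes an element -/
  code : α → BTree
  code_injective : Function.Injective code

/-- The size of the encoding of an element. -/
def sz {α : Type} [Coded α] (a : α) : ℕ := (Coded.code a).size

instance : Coded Bool where
  code b := cond b (.node .nil .nil) .nil
  code_injective := by intro a b; cases a <;> cases b <;> simp

section

variable {α β γ δ : Type} [Coded α] [Coded β] [Coded γ] [Coded δ]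

instance : Coded (α × β) where
  code p := .node (Coded.code p.1) (Coded.code p.2)
  code_injective := by
    rintro ⟨a, b⟩ ⟨a', b'⟩ h
    simp only [BTree.node.injEq] at h
    rw [Coded.code_injective h.1, Coded.code_injective h.2]

/-- The encoding of a list. -/
def codeList : List α → BTree
  | [] => .nil
  | a :: l => .node (Coded.code a) (codeList l)

instance : Coded (List α) where
  code := codeList
  code_injective := by
    intro l
    induction l with
    | nil => intro l' h; cases l' <;> simp_all [codeList]
    | cons a l ih =>
      intro l' h
      cases l' with
      | nil => simp [codeList] at h
      | cons a' l' =>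
        simp only [codeList, BTree.node.injEq] at h
        rw [Coded.code_injective h.1, ih h.2]

/-- A natural number is encoded by its list of binary digits. -/
instance : Coded ℕ where
  code n := Coded.code (Computability.encodeNat n)
  code_injective := Coded.code_injective.comp
    (Function.LeftInverse.injective Computability.decode_encodeNat)

/-- A tuple is encoded as a list. -/
instance {n : ℕ} : Coded (Fin n → α) where
  code a := Coded.code (List.ofFn a)
  code_injective := Coded.code_injective.comp List.ofFn_injective

@[simp] theorem sz_pair (a : α) (b : β) : sz (a, b) = sz a + sz b + 1 := rfl

@[simp] theorem sz_nil : sz ([] : List α) = 1 := rfl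

@[simp] theorem sz_cons (a : α) (l : List α) : sz (a :: l) = sz a + sz l + 1 := rfl

theorem sz_append (l l' : List α) : sz (l ++ l') + 1 = sz l + sz l' := by
  induction l with
  | nil => simp; omega
  | cons a l ih => simp; omega

@[simp] theorem sz_reverse (l : List α) : sz l.reverse = sz l := by
  induction l with
  | nil => rfl
  | cons a l ih =>
    have := sz_append l.reverse [a]
    simp at this ⊢
    omega

theorem length_lt_sz (l : List α) : l.length < sz l := by
  induction l with
  | nil => simp
  | cons a l ih => simp; omega

theorem sz_le_of_sublist {l l' : List α} (h : l.Sublist l') : sz l ≤ sz l' := by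
  induction h with
  | slnil => rfl
  | cons a _ ih => simp; omega
  | cons_cons a _ ih => simp; omega

theorem eval_mono (p : ℕ[X]) {m n : ℕ} (h : m ≤ n) : p.eval m ≤ p.eval n := by
  simp only [eval_eq_sum_range]
  gcongr

variable (σ : Schema)

/-- The function `f` is computed in polynomial time on the main stack, on top of other data. -/
def PT (f : α → β) : Prop :=
  ∃ (c : Prog σ) (p : ℕ[X]), ∀ (a : α) (m : List (Letter σ)),
    c.Within (regs ((Coded.code a).word σ ++ m) [] [] [])
      (regs ((Coded.code (f a)).word σ ++ m) [] [] []) (p.eval (sz a))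

/-- The predicate `P` is decided in polynomial time. -/
def PTPred (P : α → Prop) : Prop := ∃ b : α → Bool, PT σ b ∧ ∀ a, b a = true ↔ P a

variable {σ}

namespace PT

/-- The size of the value is polynomially bounded in the size of the argument, since a step of a
program adds at most one symbol. -/
theorem sz_le {f : α → β} (hf : PT σ f) : ∃ q : ℕ[X], ∀ a, sz (f a) ≤ q.eval (sz a) := by
  obtain ⟨c, p, h⟩ := hf
  refine ⟨p + X, fun a => ?_⟩
  obtain ⟨t, ht, hr⟩ := h a []
  have := hr.sum_length_le
  simp only [show (Finset.univ : Finset Reg) = {.main, .aux, .out, .cnt} from rfl] at this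
  simp at this
  simp only [sz, eval_add, eval_X] at *
  omega

/-- Functions that agree on encodings are equally computable. -/
theorem of_code {α' β' : Type} [Coded α'] [Coded β'] {f : α → β} (hf : PT σ f) (f' : α' → β')
    (i : α' → α) (hi : ∀ a, Coded.code (i a) = Coded.code a)
    (ho : ∀ a, Coded.code (f (i a)) = Coded.code (f' a)) : PT σ f' := by
  obtain ⟨c, p, h⟩ := hf
  refine ⟨c, p, fun a m => ?_⟩
  have := h (i a) m
  rwa [hi, ho, sz, hi] at this

protected theorem id : PT σ (fun a : α => a) :=
  ⟨.skip, 1, fun _ _ => by simpa using Cmd.Within.skip⟩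

theorem comp {g : β → γ} (hg : PT σ g) {f : α → β} (hf : PT σ f) : PT σ (fun a => g (f a)) := by
  obtain ⟨q, hq⟩ := hf.sz_le
  obtain ⟨c, p, h⟩ := hf
  obtain ⟨c', p', h'⟩ := hg
  refine ⟨c.seq c', p + p'.comp q, fun a m => ((h a m).seq (h' (f a) m)).mono ?_⟩
  simp only [eval_add, eval_comp]
  have := eval_mono p' (hq a)
  omega

theorem pair {f : α → β} (hf : PT σ f) {g : α → γ} (hg : PT σ g) : PT σ (fun a => (f a, g a)) := by
  obtain ⟨q, hq⟩ := hf.sz_le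
  obtain ⟨q', hq'⟩ := hg.sz_le
  obtain ⟨c, p, h⟩ := hf
  obtain ⟨c', p', h'⟩ := hg
  refine ⟨Cmd.dup.seq (c.seq (Cmd.swap.seq (c'.seq (Cmd.swap.seq (.push .main .endConst))))),
    21 * X + 5 + p + (12 * (q + X) + 6) + p' + (12 * (q' + q) + 6) + 1, fun a m => ?_⟩
  refine (Cmd.within_dup.seq ((h a _).seq (Cmd.within_swap.seq ((h' a _).seq
    (Cmd.within_swap.seq (Cmd.Within.push_main.mono (n' := 1) le_rfl)))))).mono ?_
    |> fun h => by simpa [BTree.word, Coded.code] using h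
  have h₁ := hq a
  have h₂ := hq' a
  simp [sz] at *
  omega

theorem fst : PT σ (fun p : α × β => p.1) := by
  refine ⟨(Cmd.pop .main).seq (Cmd.swap.seq Cmd.drop), 24 * X + 10, fun a m => ?_⟩
  have h₁ : (Cmd.pop .main).Within (regs ((Coded.code a).word σ ++ m) [] [] [])
      (regs ((Coded.code a.1).word σ ++ ((Coded.code a.2).word σ ++ m)) [] [] []) 1 := by
    simpa [Coded.code, BTree.word] using
      Cmd.Within.pop_main (σ := σ) (m := (Coded.code a).word σ ++ m)
  refine (h₁.seq (Cmd.within_swap.seq Cmd.within_drop)).mono ?_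
  simp [sz, Coded.code, BTree.size]
  omega

theorem snd : PT σ (fun p : α × β => p.2) := by
  refine ⟨(Cmd.pop .main).seq Cmd.drop, 24 * X + 10, fun a m => ?_⟩
  have h₁ : (Cmd.pop .main).Within (regs ((Coded.code a).word σ ++ m) [] [] [])
      (regs ((Coded.code a.1).word σ ++ ((Coded.code a.2).word σ ++ m)) [] [] []) 1 := by
    simpa [Coded.code, BTree.word] using
      Cmd.Within.pop_main (σ := σ) (m := (Coded.code a).word σ ++ m)
  refine (h₁.seq Cmd.within_drop).mono ?_
  simp [sz, Coded.code, BTree.size]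
  omega

/-- Push a fixed word on the main stack. -/
def pushWord (l : List (Letter σ)) : Prog σ := l.foldr (fun s c => c.seq (.push .main s)) .skip

theorem within_pushWord (l m : List (Letter σ)) {a o c : List (Letter σ)} :
    (pushWord l).Within (regs m a o c) (regs (l ++ m) a o c) (l.length + 1) := by
  induction l with
  | nil => exact Cmd.Within.skip
  | cons s l ih => exact ih.seq Cmd.Within.push_main

theorem const (b : β) : PT σ (fun _ : α => b) := by
  refine ⟨Cmd.drop.seq (pushWord ((Coded.code b).word σ)), 12 * X + 3 + C (sz b + 1),
    fun a m => (Cmd.within_drop.seq (within_pushWord _ _)).mono ?_⟩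
  simp [sz]

theorem ite {P : α → Prop} [DecidablePred P] (hP : PTPred σ P) {f g : α → β} (hf : PT σ f)
    (hg : PT σ g) : PT σ (fun a => if P a then f a else g a) := by
  obtain ⟨b, ⟨c, p, h⟩, hb⟩ := hP
  obtain ⟨c', p', h'⟩ := hf
  obtain ⟨c'', p'', h''⟩ := hg
  refine ⟨Cmd.dup.seq (c.seq (.branch .main fun
    | some .endConst => (Cmd.pop .main).seq ((Cmd.pop .main).seq ((Cmd.pop .main).seq c'))
    | _ => (Cmd.pop .main).seq c'')), 21 * X + 5 + p + p' + p'' + 4, fun a m => ?_⟩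
  by_cases ha : P a
  · refine (Cmd.within_dup.seq ((h a _).seq (.branch (n := 3 + p'.eval (sz a)) ?_))).mono ?_
    · simp only [(hb a).2 ha, if_pos ha]
      refine (Cmd.Within.pop_main.seq (Cmd.Within.pop_main.seq
        (Cmd.Within.pop_main.seq (h' a m)))).mono ?_
      omega
    · simp [sz]; omega
  · have hb' : b a = false := by rw [← Bool.not_eq_true, hb]; exact ha
    refine (Cmd.within_dup.seq ((h a _).seq (.branch (n := 1 + p''.eval (sz a)) ?_))).mono ?_
    · simp only [hb', if_neg ha]
      exact Cmd.Within.pop_main.seq (h'' a m)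
    · simp [sz]; omega

/-- Case distinction on a list. A nonempty list `a :: l` has the same code as the pair `(a, l)`. -/
theorem listCases {l : γ → List α} (hl : PT σ l) {F : γ → List α → β}
    (h₁ : PT σ (fun c => F c []))
    (h₂ : PT σ (fun p : (α × List α) × γ => F p.2 (p.1.1 :: p.1.2))) :
    PT σ (fun c => F c (l c)) := by
  suffices h : PT σ (fun p : List α × γ => F p.2 p.1) from h.comp (hl.pair .id)
  obtain ⟨c, p, h⟩ := h₁
  obtain ⟨c', p', h'⟩ := h₂
  refine ⟨(Cmd.pop .main).seq (.branch .main fun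
    | some .endConst => (Cmd.push .main .endConst).seq c'
    | _ => (Cmd.pop .main).seq c), p + p' + 3, fun x m => ?_⟩
  obtain ⟨_ | ⟨a, l⟩, x⟩ := x
  · refine (Cmd.Within.pop_main.seq (.branch (n := 1 + p.eval (sz x)) ?_)).mono ?_
    · exact Cmd.Within.pop_main.seq (h x m)
    · have := eval_mono p (show sz x ≤ sz (([] : List α), x) by simp; omega)
      simp at this ⊢
      omega
  · refine (Cmd.Within.pop_main.seq (.branch (n := 1 + p'.eval (sz ((a, l), x))) ?_)).mono ?_
    · exact Cmd.Within.push_main.seq (h' ((a, l), x) m)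
    · simp; omega

open Classical in
theorem decideEq : PT σ (fun p : α × α => decide (p.1 = p.2)) := by
  refine ⟨(Cmd.pop .main).seq ((Cmd.moveTree false).seq ((Cmd.moveTree true).seq
    (Cmd.compare.seq (.branch .cnt fun
      | none => pushWord [.endConst, .sep, .sep]
      | some _ => Cmd.clearCnt.seq (pushWord [.sep]))))), 20 * X + 20, fun x m => ?_⟩
  obtain ⟨a, b⟩ := x
  have h₀ : (Cmd.pop .main).Within (regs ((Coded.code (a, b)).word σ ++ m) [] [] [])
      (regs ((Coded.code a).word σ ++ ((Coded.code b).word σ ++ m)) [] [] []) 1 := by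
    simpa [Coded.code, BTree.word] using
      Cmd.Within.pop_main (σ := σ) (m := (Coded.code (a, b)).word σ ++ m)
  have h₁ : (Cmd.moveTree false).Within
      (regs ((Coded.code a).word σ ++ ((Coded.code b).word σ ++ m)) [] [] [])
      (regs ((Coded.code b).word σ ++ m) ((Coded.code a).word σ).reverse [] [])
      (8 * sz a + 2) := by
    simpa [sz] using Cmd.within_moveTree (a := []) (o := []) false
  have h₂ : (Cmd.moveTree true).Within
      (regs ((Coded.code b).word σ ++ m) ((Coded.code a).word σ).reverse [] [])
      (regs m ((Coded.code a).word σ).reverse ((Coded.code b).word σ).reverse [])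
      (8 * sz b + 2) := by
    simpa [sz] using Cmd.within_moveTree (a := ((Coded.code a).word σ).reverse) (o := []) true
  obtain ⟨c', ⟨hc, hl⟩, h₃⟩ := Cmd.within_compare (m := m) (c := [])
    (a := ((Coded.code a).word σ).reverse) (o := ((Coded.code b).word σ).reverse)
  simp only [List.length_reverse, BTree.length_word, true_and, List.reverse_inj,
    BTree.word_injective.eq_iff, Coded.code_injective.eq_iff, List.length_nil, zero_add] at hc hl h₃
  refine (h₀.seq (h₁.seq (h₂.seq (h₃.seq (.branch (n := 4 * (sz a + sz b) + 4) ?_))))).mono ?_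
  · cases c' with
    | nil =>
      have hab := hc.1 rfl
      subst hab
      simpa [Coded.code, BTree.word] using
        (within_pushWord (σ := σ) [.endConst, .sep, .sep] m).mono
          (show _ ≤ 4 * (sz a + sz a) + 4 by simp)
    | cons s c' =>
      have hab : a ≠ b := fun h => by simpa using hc.2 h
      have h := (Cmd.within_clearCnt (σ := σ) (m := m) (a := []) (o := []) (c := s :: c')).seq
        (within_pushWord [.sep] m)
      have h' := h.mono (n' := 4 * (sz a + sz b) + 4) (by simp [sz] at hl ⊢; omega)
      simpa [Coded.code, BTree.word, hab] using h'
  · simp [sz, Coded.code, BTree.size]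
    omega

/-- The loop that folds a list: the body `c` expects a pair of a nonempty list and a state, and
leaves a pair of the rest of the list and the next state. The invariant `inv` serves to bound the
time `n` of a single step. -/
theorem within_fold {S : Type} [Coded S] {c : Prog σ} {g : S → α → S} {inv : List α → S → Prop}
    {n : ℕ} (hinv : ∀ x l s, inv (x :: l) s → inv l (g s x))
    (h : ∀ x l s m, inv (x :: l) s → c.Within (regs ((Coded.code ((x, l), s)).word σ ++ m) [] [] [])
      (regs ((Coded.code (l, g s x)).word σ ++ m) [] [] []) n)
    (l : List α) (s : S) (hl : inv l s) (m : List (Letter σ)) :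
    (Cmd.loop .main (fun | some .endConst => true | _ => false)
      ((Cmd.push .main .endConst).seq (c.seq (.pop .main)))).Within
      (regs ((Coded.code l).word σ ++ ((Coded.code s).word σ ++ m)) [] [] [])
      (regs (.sep :: ((Coded.code (l.foldl g s)).word σ ++ m)) [] [] [])
      (l.length * (n + 3) + 1) := by
  induction l generalizing s with
  | nil => exact (Cmd.Within.finish rfl).mono (by simp)
  | cons x l ih =>
    refine (Cmd.Within.step (n := n + 2) rfl ?_ (ih (g s x) (hinv _ _ _ hl))).mono ?_
    · refine (Cmd.Within.push_main.seq (n := 1) (n' := n + 1) ?_).mono (by omega)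
      have h₁ := (h x l s m hl).seq (Cmd.Within.pop_main)
      simpa [Coded.code, codeList, BTree.word] using h₁
    · simp; ring_nf; omega

/-- Iteration along a list, where a step enlarges the state by an amount that is polynomial in the
size of the parameters. -/
theorem foldl {S : Type} [Coded S] {l : γ → List α} (hl : PT σ l) {s₀ : γ → S} (hs : PT σ s₀)
    {g : γ → S → α → S} (hg : PT σ (fun p : γ × S × α => g p.1 p.2.1 p.2.2))
    (hb : ∃ q : ℕ[X], ∀ c s x, sz (g c s x) ≤ sz s + q.eval (sz c + sz x)) :
    PT σ (fun c => (l c).foldl (g c) (s₀ c)) := by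
  obtain ⟨q, hq⟩ := hb
  obtain ⟨ql, hql⟩ := hl.sz_le
  obtain ⟨qs, hqs⟩ := hs.sz_le
  have hG : PT σ (fun p : (α × List α) × (S × γ) =>
      (p.1.2, (g p.2.2 p.2.1 p.1.1, p.2.2))) :=
    (snd.comp fst).pair ((hg.comp ((snd.comp snd).pair ((fst.comp snd).pair (fst.comp fst)))).pair
      (snd.comp snd))
  obtain ⟨c, p, h⟩ := hG
  suffices H : PT σ (fun c => ((l c).foldl (g c) (s₀ c), c)) from fst.comp H
  obtain ⟨c', p', h'⟩ := hl.pair (hs.pair .id)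
  -- a bound for the size of the state during the iteration
  let B : ℕ[X] := qs + ql * q.comp (X + ql)
  refine ⟨c'.seq ((Cmd.pop .main).seq ((Cmd.loop .main
      (fun | some .endConst => true | _ => false)
      ((Cmd.push .main .endConst).seq (c.seq (.pop .main)))).seq (.pop .main))),
    p' + 1 + (ql * (p.comp (ql + B + X + 3) + 3) + 1) + 1, fun a m => ?_⟩
  have hf := within_fold (σ := σ) (c := c) (g := fun (s : S × γ) x => (g s.2 s.1 x, s.2))
    (inv := fun l' s => s.2 = a ∧ sz l' ≤ ql.eval (sz a) ∧
      sz s.1 + l'.length * q.eval (sz a + ql.eval (sz a)) ≤ B.eval (sz a))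
    (n := (p.comp (ql + B + X + 3)).eval (sz a)) ?_ ?_ (l a) (s₀ a, a) ?_ m
  · have hp : ∀ l' : List α, l'.foldl (fun (s : S × γ) x => (g s.2 s.1 x, s.2)) (s₀ a, a) =
        (l'.foldl (g a) (s₀ a), a) := by
      intro l'
      generalize s₀ a = s
      induction l' generalizing s with
      | nil => rfl
      | cons x l' ih => exact ih _
    rw [hp] at hf
    have h₁ : (Cmd.pop .main).Within
        (regs ((Coded.code (l a, s₀ a, a)).word σ ++ m) [] [] [])
        (regs ((Coded.code (l a)).word σ ++ ((Coded.code (s₀ a, a)).word σ ++ m)) [] [] []) 1 := by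
      simpa [Coded.code, BTree.word] using
        Cmd.Within.pop_main (σ := σ) (m := (Coded.code (l a, s₀ a, a)).word σ ++ m)
    refine ((h' a m).seq (h₁.seq (hf.seq Cmd.Within.pop_main))).mono ?_
    have hle : (l a).length ≤ ql.eval (sz a) := (length_lt_sz _).le.trans (hql a)
    have := Nat.mul_le_mul_right ((p.comp (ql + B + X + 3)).eval (sz a) + 3) hle
    simp only [eval_add, eval_mul, eval_one, eval_ofNat]
    omega
  · rintro x l' ⟨s, c⟩ ⟨rfl, h₁, h₂⟩
    dsimp only at h₁ h₂ ⊢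
    refine ⟨rfl, ?_, ?_⟩
    · simp at h₁; omega
    · have h₃ := hq c s x
      have h₄ : sz x ≤ ql.eval (sz c) := by simp at h₁; omega
      have h₅ := eval_mono q (Nat.add_le_add_left h₄ (sz c))
      simp only [List.length_cons, Nat.add_mul] at h₂ ⊢
      omega
  · rintro x l' ⟨s, c⟩ m ⟨rfl, h₁, h₂⟩
    refine (h ((x, l'), s, c) m).mono ?_
    rw [eval_comp]
    apply eval_mono
    simp at h₁ h₂ ⊢
    have : sz s ≤ B.eval (sz c) := by omega
    omega
  · refine ⟨rfl, hql a, ?_⟩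
    have hle : (l a).length ≤ ql.eval (sz a) := (length_lt_sz _).le.trans (hql a)
    simp only [B, eval_add, eval_mul, eval_comp, eval_X]
    exact Nat.add_le_add (hqs a) (Nat.mul_le_mul_right _ hle)

end PT

end

/-- All lists of length `n` of elements of a list. -/
def tuples {α : Type} (l : List α) : ℕ → List (List α)
  | 0 => [[]]
  | n + 1 => (tuples l n).flatMap fun t => l.map fun a => a :: t

theorem mem_tuples {α : Type} {l : List α} {n : ℕ} {t : List α} :
    t ∈ tuples l n ↔ t.length = n ∧ ∀ a ∈ t, a ∈ l := by
  induction n generalizing t with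
  | zero => simp +contextual [tuples]
  | succ n ih =>
    simp only [tuples, List.mem_flatMap, List.mem_map, ih]
    constructor
    · rintro ⟨t, ⟨rfl, h⟩, a, ha, rfl⟩
      simpa [ha] using h
    · rintro ⟨h, h'⟩
      obtain _ | ⟨a, t⟩ := t
      · simp at h
      · simp at h h'
        exact ⟨t, ⟨h, h'.2⟩, a, h'.1, rfl⟩

section

variable {α β γ δ : Type} [Coded α] [Coded β] [Coded γ] [Coded δ] {σ : Schema}

namespace PT

theorem cons {f : γ → α} (hf : PT σ f) {l : γ → List α} (hl : PT σ l) :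
    PT σ (fun c => f c :: l c) :=
  (hf.pair hl).of_code _ id (fun _ => rfl) (fun _ => rfl)

theorem reverse {l : γ → List α} (hl : PT σ l) : PT σ (fun c => (l c).reverse) := by
  have h := foldl hl (s₀ := fun _ => ([] : List α)) (const _)
    (g := fun _ s x => x :: s) ((snd.comp snd).cons (fst.comp snd))
    ⟨X + 1, fun c s x => by simp; omega⟩
  simpa using h

theorem append {l l' : γ → List α} (hl : PT σ l) (hl' : PT σ l') :
    PT σ (fun c => l c ++ l' c) := by
  have h := foldl hl.reverse (s₀ := l') hl'
    (g := fun _ s x => x :: s) ((snd.comp snd).cons (fst.comp snd))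
    ⟨X + 1, fun c s x => by simp; omega⟩
  simpa using h

theorem flatMap {l : γ → List α} (hl : PT σ l) {f : γ → α → List β}
    (hf : PT σ (fun p : γ × α => f p.1 p.2)) : PT σ (fun c => (l c).flatMap (f c)) := by
  obtain ⟨q, hq⟩ := hf.sz_le
  have h := foldl hl (s₀ := fun _ => ([] : List β)) (const _)
    (g := fun c s x => (f c x).reverse ++ s)
    ((hf.comp (fst.pair (snd.comp snd))).reverse.append (fst.comp snd))
    ⟨q.comp (X + 1), fun c s x => by
      have h₁ := sz_append (f c x).reverse s
      have h₂ := hq (c, x)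
      simp at h₁ h₂ ⊢
      omega⟩
  have he : ∀ c (s : List β) (l : List α),
      (l.foldl (fun s x => (f c x).reverse ++ s) s).reverse = s.reverse ++ l.flatMap (f c) := by
    intro c s l
    induction l generalizing s with
    | nil => simp
    | cons x l ih => rw [List.foldl_cons, ih]; simp
  simpa only [he, List.reverse_nil, List.nil_append] using h.reverse

theorem map {l : γ → List α} (hl : PT σ l) {f : γ → α → β}
    (hf : PT σ (fun p : γ × α => f p.1 p.2)) : PT σ (fun c => (l c).map (f c)) := by
  simpa [List.map_eq_flatMap] using hl.flatMap (f := fun c x => [f c x]) (hf.cons (const []))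

theorem filter {l : γ → List α} (hl : PT σ l) {P : γ → α → Prop} [∀ c, DecidablePred (P c)]
    (hP : PTPred σ (fun p : γ × α => P p.1 p.2)) :
    PT σ (fun c => (l c).filter (fun x => decide (P c x))) := by
  have h := hl.flatMap (f := fun c x => if P c x then [x] else [])
    (ite hP (snd.cons (const [])) (const []))
  convert h using 2 with c
  induction l c with
  | nil => rfl
  | cons x l ih => by_cases hx : P c x <;> simp [hx, ih]

theorem headD {l : γ → List α} (hl : PT σ l) (d : α) : PT σ (fun c => (l c).headD d) :=
  listCases hl (F := fun _ l => l.headD d) (const d) (fst.comp fst)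

theorem tail {l : γ → List α} (hl : PT σ l) : PT σ (fun c => (l c).tail) :=
  listCases hl (F := fun _ l => l.tail) (const []) (snd.comp fst)

theorem getD {l : γ → List α} (hl : PT σ l) (n : ℕ) (d : α) : PT σ (fun c => (l c).getD n d) := by
  induction n generalizing l with
  | zero =>
    convert hl.headD d using 2 with c
    cases l c <;> rfl
  | succ n ih =>
    convert ih hl.tail using 2 with c
    cases l c <;> simp

/-- Mapping along a fixed list. -/
theorem map_const {ι : Type} (l : List ι) {f : ι → γ → α} (hf : ∀ i ∈ l, PT σ (f i)) :
    PT σ (fun c => l.map (fun i => f i c)) := by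
  induction l with
  | nil => exact const _
  | cons i l ih =>
    exact (hf i (by simp)).cons (ih fun j hj => hf j (by simp [hj]))

theorem flatMap_const {ι : Type} (l : List ι) {f : ι → γ → List α} (hf : ∀ i ∈ l, PT σ (f i)) :
    PT σ (fun c => l.flatMap (fun i => f i c)) := by
  induction l with
  | nil => exact const _
  | cons i l ih =>
    exact (hf i (by simp)).append (ih fun j hj => hf j (by simp [hj]))

/-- A tuple of fixed length is computed componentwise. -/
theorem tuple {n : ℕ} {f : γ → Fin n → α} (hf : ∀ i, PT σ (fun c => f c i)) : PT σ f := by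
  have h := map_const (List.finRange n) (f := fun i c => f c i) fun i _ => hf i
  exact h.of_code _ id (fun _ => rfl) fun c => by
    change _ = Coded.code (List.ofFn (f c))
    rw [List.ofFn_eq_map]
    rfl

theorem ofFn {n : ℕ} : PT σ (fun a : Fin n → α => List.ofFn a) :=
  PT.id.of_code _ (fun a => List.ofFn a) (fun _ => rfl) (fun _ => rfl)

end PT

namespace PTPred

theorem of_iff {P Q : γ → Prop} (hP : PTPred σ P) (h : ∀ c, P c ↔ Q c) : PTPred σ Q :=
  let ⟨b, hb, hP⟩ := hP
  ⟨b, hb, fun c => (hP c).trans (h c)⟩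

theorem const (p : Prop) : PTPred σ (fun _ : γ => p) := by
  by_cases h : p
  · exact ⟨fun _ => true, PT.const _, by simp [h]⟩
  · exact ⟨fun _ => false, PT.const _, by simp [h]⟩

theorem eq {f g : γ → α} (hf : PT σ f) (hg : PT σ g) : PTPred σ (fun c => f c = g c) := by
  classical
  exact ⟨_, PT.decideEq.comp (hf.pair hg), by simp⟩

theorem ite {P Q R : γ → Prop} (hP : PTPred σ P) (hQ : PTPred σ Q) (hR : PTPred σ R) :
    PTPred σ (fun c => (P c ∧ Q c) ∨ (¬ P c ∧ R c)) := by
  classical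
  obtain ⟨b, hb, hQ⟩ := hQ
  obtain ⟨b', hb', hR⟩ := hR
  refine ⟨_, PT.ite hP hb hb', fun c => ?_⟩
  by_cases h : P c <;> simp [h, hQ, hR]

theorem and {P Q : γ → Prop} (hP : PTPred σ P) (hQ : PTPred σ Q) :
    PTPred σ (fun c => P c ∧ Q c) :=
  (hP.ite hQ (const False)).of_iff (by simp)

theorem not {P : γ → Prop} (hP : PTPred σ P) : PTPred σ (fun c => ¬ P c) :=
  (hP.ite (const False) (const True)).of_iff (by simp)

theorem or {P Q : γ → Prop} (hP : PTPred σ P) (hQ : PTPred σ Q) :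
    PTPred σ (fun c => P c ∨ Q c) :=
  (hP.ite (const True) hQ).of_iff (by tauto)

theorem exists_mem {l : γ → List α} (hl : PT σ l) {P : γ → α → Prop}
    (hP : PTPred σ (fun p : γ × α => P p.1 p.2)) : PTPred σ (fun c => ∃ x ∈ l c, P c x) := by
  classical
  exact (eq (hl.filter hP) (PT.const [])).not.of_iff (by simp)

theorem mem {f : γ → α} (hf : PT σ f) {l : γ → List α} (hl : PT σ l) :
    PTPred σ (fun c => f c ∈ l c) :=
  (exists_mem hl (P := fun c x => x = f c) (eq PT.snd (hf.comp PT.fst))).of_iff (by simp)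

/-- Conjunctions along a fixed list. -/
theorem forall_const {ι : Type} (l : List ι) {P : ι → γ → Prop} (hP : ∀ i ∈ l, PTPred σ (P i)) :
    PTPred σ (fun c => ∀ i ∈ l, P i c) := by
  induction l with
  | nil => exact (const True).of_iff (by simp)
  | cons i l ih =>
    exact ((hP i (by simp)).and (ih fun j hj => hP j (by simp [hj]))).of_iff (by simp)

end PTPred

/-- Case distinction on an element of a finite type. -/
theorem PT.finCases [Finite α] {f : α → γ → β} (hf : ∀ a, PT σ (f a)) :
    PT σ (fun p : α × γ => f p.1 p.2) := by
  classical
  have := Fintype.ofFinite α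
  suffices h : ∀ l : List α, l ≠ [] →
      ∃ F : α × γ → β, PT σ F ∧ ∀ p : α × γ, p.1 ∈ l → F p = f p.1 p.2 by
    by_cases hα : Nonempty α
    · obtain ⟨F, hF, h⟩ := h Finset.univ.toList (by simp [Finset.univ_eq_empty_iff])
      convert hF using 2 with p
      exact (h p (by simp)).symm
    · exact ⟨.skip, 0, fun p => (hα ⟨p.1⟩).elim⟩
  intro l
  induction l with
  | nil => simp
  | cons a l ih =>
    intro _
    by_cases hl : l = []
    · exact ⟨fun p => f a p.2, (hf a).comp PT.snd, by rintro ⟨x, y⟩ h; simp_all⟩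
    · obtain ⟨F, hF, h⟩ := ih hl
      refine ⟨_, PT.ite (P := fun p : α × γ => p.1 = a) (PTPred.eq PT.fst (PT.const a))
        ((hf a).comp PT.snd) hF, ?_⟩
      rintro ⟨x, y⟩ hx
      by_cases hxa : x = a
      · simp [hxa]
      · simp only [List.mem_cons, hxa, false_or] at hx
        simp [hxa, h (x, y) hx]

theorem PT.of_finite [Finite α] (f : α → β) : PT σ f :=
  (PT.finCases (γ := Bool) (f := fun a _ => f a) fun _ => PT.const _).comp
    (PT.id.pair (.const true))

theorem PT.tuples {l : γ → List α} (hl : PT σ l) (n : ℕ) :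
    PT σ (fun c => SPDatalog.tuples (l c) n) := by
  induction n with
  | zero => exact PT.const _
  | succ n ih =>
    refine PT.flatMap (f := fun c t => (l c).map fun a => a :: t) ih ?_
    exact PT.map (f := fun (p : γ × List α) a => a :: p.2) (hl.comp .fst)
      (PT.snd.cons (PT.snd.comp PT.fst))

end

/-! ### Terms and constants of a program -/

section Terms

variable {σ : Schema}

/-- The terms that occur in a literal. -/
def Literal.terms : Literal σ → List Term
  | .edb _ t => List.ofFn t
  | .idb _ t => List.ofFn t
  | .eq s t => [s, t]
  | .notEdb _ t => List.ofFn t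
  | .ne s t => [s, t]

/-- The terms that occur in a rule. -/
def Rule.terms (r : Rule σ) : List Term :=
  List.ofFn (fun i => Term.var (r.headVars i)) ++ r.body.flatMap Literal.terms

/-- The terms that occur in a program. -/
def Program.terms (P : Program σ) : List Term := P.rules.flatMap Rule.terms

/-- The constants that occur in a program. -/
def Program.consts (P : Program σ) : List Dom :=
  P.terms.flatMap fun | .var _ => [] | .const c => [c]

/-- A strict upper bound for the variables that occur in a program. -/
def Program.width (P : Program σ) : ℕ :=
  (P.terms.map fun | .var x => x + 1 | .const _ => 0).sum

variable {P : Program σ}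

theorem Program.mem_terms_of_mem_body {r : Rule σ} (hr : r ∈ P.rules) {l : Literal σ}
    (hl : l ∈ r.body) {t : Term} (ht : t ∈ l.terms) : t ∈ P.terms := by
  simp only [Program.terms, Rule.terms, List.mem_flatMap, List.mem_append]
  exact ⟨r, hr, .inr ⟨l, hl, ht⟩⟩

theorem Program.mem_consts {c : Dom} (hc : Term.const c ∈ P.terms) : c ∈ P.consts :=
  List.mem_flatMap.2 ⟨_, hc, by simp⟩

theorem Program.lt_width {x : Var} (hx : Term.var x ∈ P.terms) : x < P.width :=
  List.le_sum_of_mem (x := x + 1) (List.mem_map.2 ⟨Term.var x, hx, rfl⟩)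

theorem Program.headVars_lt_width {r : Rule σ} (hr : r ∈ P.rules) (i : Fin r.headRel.arity) :
    r.headVars i < P.width := by
  apply Program.lt_width
  simp only [Program.terms, Rule.terms, List.mem_flatMap, List.mem_append, List.mem_ofFn]
  exact ⟨r, hr, .inl ⟨i, rfl⟩⟩

/-! ### The least model and renamings of constants -/

/-- The image of a fact under a renaming of the constants. -/
def Fact.map (π : Equiv.Perm Dom) (f : Fact σ) : Fact σ := ⟨f.1, fun i => π (f.2 i)⟩

@[simp] theorem Fact.map_symm_map (π : Equiv.Perm Dom) (f : Fact σ) :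
    (f.map π).map π.symm = f := by simp [Fact.map]

@[simp] theorem Fact.map_map_symm (π : Equiv.Perm Dom) (f : Fact σ) :
    (f.map π.symm).map π = f := by simp [Fact.map]

theorem Fact.map_injective (π : Equiv.Perm Dom) : Function.Injective (Fact.map (σ := σ) π) :=
  Function.LeftInverse.injective (g := Fact.map π.symm) (Fact.map_symm_map π)

/-- Truth of literals is preserved by renamings of the constants, if the renaming fixes the
constants of the literal, and is monotone in the intensional relations. -/
theorem Literal.Holds.map {l : Literal σ} {I J : Instance σ} {X Y : IDBInterp} {g h : Var → Dom}
    (π : Equiv.Perm Dom) (hc : ∀ c, Term.const c ∈ l.terms → π c = c)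
    (hg : ∀ x, Term.var x ∈ l.terms → h x = π (g x)) (hI : ∀ f : Fact σ, f.map π ∈ J ↔ f ∈ I)
    (hX : ∀ S v, (∀ i, ∃ t ∈ l.terms, v i = t.val g) → X S v → Y S (fun i => π (v i)))
    (hl : l.Holds I X g) : l.Holds J Y h := by
  have hv : ∀ t ∈ l.terms, t.val h = π (t.val g) := by
    intro t ht
    cases t with
    | var x => exact hg x ht
    | const c => exact (hc c ht).symm
  cases l with
  | edb R t =>
    have : (fun i => (t i).val h) = fun i => π ((t i).val g) :=
      funext fun i => hv _ (by simp [Literal.terms])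
    simp only [Literal.Holds, this] at hl ⊢
    exact (hI _).2 hl
  | idb S t =>
    have : (fun i => (t i).val h) = fun i => π ((t i).val g) :=
      funext fun i => hv _ (by simp [Literal.terms])
    simp only [Literal.Holds, this] at hl ⊢
    exact hX _ _ (fun i => ⟨t i, by simp [Literal.terms], rfl⟩) hl
  | eq s t =>
    simp only [Literal.Holds] at hl ⊢
    rw [hv s (by simp [Literal.terms]), hv t (by simp [Literal.terms]), hl]
  | notEdb R t =>
    have : (fun i => (t i).val h) = fun i => π ((t i).val g) :=
      funext fun i => hv _ (by simp [Literal.terms])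
    simp only [Literal.Holds, this] at hl ⊢
    exact fun h => hl ((hI _).1 h)
  | ne s t =>
    simp only [Literal.Holds] at hl ⊢
    rw [hv s (by simp [Literal.terms]), hv t (by simp [Literal.terms])]
    exact fun h => hl (π.injective h)

theorem Literal.Holds.mono {l : Literal σ} {I : Instance σ} {X Y : IDBInterp} {g : Var → Dom}
    (hX : ∀ S v, X S v → Y S v) (hl : l.Holds I X g) : l.Holds I Y g :=
  hl.map (Equiv.refl _) (fun _ _ => rfl) (fun _ _ => rfl) (fun _ => Iff.rfl) fun S v _ => hX S v

/-- The least model of a program over an instance. -/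
def Program.least (P : Program σ) (I : Instance σ) : IDBInterp :=
  fun S v => ∀ X, P.IsModel I X → X S v

theorem Program.least_isModel (I : Instance σ) : P.IsModel I (P.least I) :=
  fun r hr g h X hX => hX r hr g fun l hl => (h l hl).mono fun _ _ h' => h' X hX

/-- Renamings that fix the constants of the program are automorphisms of its semantics. -/
theorem Program.answer_map {π : Equiv.Perm Dom} (hπ : ∀ c ∈ P.consts, π c = c) {I J : Instance σ}
    (hI : ∀ f : Fact σ, f.map π ∈ J ↔ f ∈ I) {a : Fin P.arity → Dom} (ha : a ∈ P.answer I) :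
    (fun i => π (a i)) ∈ P.answer J := by
  intro X hX
  refine ha (fun S v => X S fun i => π (v i)) fun r hr g h => hX r hr (fun x => π (g x)) ?_
  exact fun l hl => (h l hl).map π
    (fun c hc => hπ c (Program.mem_consts (Program.mem_terms_of_mem_body hr hl hc)))
    (fun _ _ => rfl) hI fun _ _ _ h => h

/-- A finite set of constants can be moved into a set with enough elements, keeping another
finite set fixed. -/
theorem exists_renaming (B V D : Finset Dom) (h : (V \ B).card ≤ (D \ B).card) :
    ∃ π : Equiv.Perm Dom, (∀ b ∈ B, π b = b) ∧ ∀ v ∈ V, π v ∈ B ∪ D := by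
  obtain ⟨e⟩ : Nonempty ((V \ B : Finset Dom) ↪ (D \ B : Finset Dom)) :=
    Function.Embedding.nonempty_of_card_le (by simpa using h)
  let g : (B ∪ V : Finset Dom) → Dom := fun x =>
    if hx : x.1 ∈ B then x.1 else e ⟨x.1, Finset.mem_sdiff.2
      ⟨(Finset.mem_union.1 x.2).resolve_left hx, hx⟩⟩
  have hg : ∀ x, x.1 ∉ B → g x ∈ D ∧ g x ∉ B := by
    intro x hx
    simp only [g, dif_neg hx]
    exact Finset.mem_sdiff.1 (e _).2
  obtain ⟨π, hπ⟩ := Equiv.Perm.exists_extending_pair (fun x : (B ∪ V : Finset Dom) => x.1) g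
    Subtype.val_injective (by
      intro x y hxy
      by_cases hx : x.1 ∈ B <;> by_cases hy : y.1 ∈ B
      · simp only [g, dif_pos hx, dif_pos hy] at hxy
        exact Subtype.ext hxy
      · have := (hg y hy).2
        rw [← hxy] at this
        simp [g, hx] at this
      · have := (hg x hx).2
        rw [hxy] at this
        simp [g, hy] at this
      · simp only [g, dif_neg hx, dif_neg hy, Subtype.val_inj, e.injective.eq_iff,
          Subtype.mk.injEq] at hxy
        exact hxy)
  refine ⟨π, fun b hb => ?_, fun v hv => ?_⟩
  · rw [hπ ⟨b, by simp [hb]⟩]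
    simp [g, hb]
  · rw [hπ ⟨v, by simp [hv]⟩]
    by_cases hvB : v ∈ B
    · simp [g, hvB]
    · exact Finset.mem_union_right _ (hg _ hvB).1

/-! ### Small repairs -/

/-- A derivation uses finitely many facts positively and finitely many negatively. -/
theorem Program.exists_support {J : Instance σ} {a : Fin P.arity → Dom} (ha : a ∈ P.answer J) :
    ∃ Pos Neg : Finset (Fact σ), Disjoint Pos Neg ∧
      ∀ I, Pos ⊆ I → Disjoint Neg I → a ∈ P.answer I := by
  suffices h : P.IsModel J fun S v => ∃ Pos Neg : Finset (Fact σ), Pos ⊆ J ∧ Disjoint Neg J ∧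
      ∀ I, Pos ⊆ I → Disjoint Neg I → P.least I S v by
    obtain ⟨Pos, Neg, h₁, h₂, h₃⟩ := ha _ h
    exact ⟨Pos, Neg, (Finset.disjoint_of_subset_right h₁ h₂).symm, h₃⟩
  intro r hr g h
  suffices h' : ∀ b : List (Literal σ), (∀ l ∈ b, l ∈ r.body) →
      ∃ Pos Neg : Finset (Fact σ), Pos ⊆ J ∧ Disjoint Neg J ∧
        ∀ I, Pos ⊆ I → Disjoint Neg I → ∀ l ∈ b, l.Holds I (P.least I) g by
    obtain ⟨Pos, Neg, h₁, h₂, h₃⟩ := h' r.body fun _ h => h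
    exact ⟨Pos, Neg, h₁, h₂, fun I hI hI' => Program.least_isModel I r hr g (h₃ I hI hI')⟩
  intro b hb
  induction b with
  | nil => exact ⟨∅, ∅, by simp⟩
  | cons l b ih =>
    obtain ⟨Pos, Neg, h₁, h₂, h₃⟩ := ih fun l hl => hb l (List.mem_cons_of_mem _ hl)
    obtain ⟨Pos', Neg', h₁', h₂', h₃'⟩ : ∃ Pos Neg : Finset (Fact σ), Pos ⊆ J ∧ Disjoint Neg J ∧
        ∀ I, Pos ⊆ I → Disjoint Neg I → l.Holds I (P.least I) g := by
      have hl := h l (hb l (List.mem_cons_self ..))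
      cases l with
      | edb R t => exact ⟨{⟨R, fun i => (t i).val g⟩}, ∅,
          by simpa [Literal.Holds] using hl, by simp,
          fun I hI _ => by simpa [Literal.Holds] using hI⟩
      | idb S t => exact hl
      | eq s t => exact ⟨∅, ∅, by simp, by simp, fun _ _ _ => hl⟩
      | notEdb R t => exact ⟨∅, {⟨R, fun i => (t i).val g⟩}, by simp,
          by simpa [Literal.Holds] using hl,
          fun I _ hI => by simpa [Literal.Holds] using hI⟩
      | ne s t => exact ⟨∅, ∅, by simp, by simp, fun _ _ _ => hl⟩
    refine ⟨Pos ∪ Pos', Neg ∪ Neg', Finset.union_subset h₁ h₁',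
      Finset.disjoint_union_left.2 ⟨h₂, h₂'⟩, fun I hI hI' => ?_⟩
    rw [Finset.disjoint_union_left] at hI'
    simp only [List.mem_cons, forall_eq_or_imp]
    exact ⟨h₃' I (Finset.union_subset_right hI) hI'.2,
      h₃ I (Finset.union_subset_left hI) hI'.1⟩

/-- A single bound holds for the size of the supports of all tuples that can be answers at all,
because there are finitely many tuples up to renaming. -/
theorem Program.exists_support_card_le (P : Program σ) : ∃ K, ∀ a : Fin P.arity → Dom,
    (∃ J, a ∈ P.answer J) → ∃ Pos Neg : Finset (Fact σ), Disjoint Pos Neg ∧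
      Pos.card + Neg.card ≤ K ∧ ∀ I, Pos ⊆ I → Disjoint Neg I → a ∈ P.answer I := by
  have h : ∀ a : Fin P.arity → Dom, ∃ K, (∃ J, a ∈ P.answer J) →
      ∃ Pos Neg : Finset (Fact σ), Disjoint Pos Neg ∧
        Pos.card + Neg.card ≤ K ∧ ∀ I, Pos ⊆ I → Disjoint Neg I → a ∈ P.answer I := by
    intro a
    by_cases ha : ∃ J, a ∈ P.answer J
    · obtain ⟨J, hJ⟩ := ha
      obtain ⟨Pos, Neg, h₁, h₂⟩ := Program.exists_support hJ
      exact ⟨_, fun _ => ⟨Pos, Neg, h₁, le_rfl, h₂⟩⟩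
    · exact ⟨0, fun h => (ha h).elim⟩
  choose K hK using h
  -- up to renaming, all tuples have their entries in a finite set `D`
  obtain ⟨D, hD, hD'⟩ : ∃ D : Finset Dom, P.consts.toFinset ⊆ D ∧
      P.arity ≤ (D \ P.consts.toFinset).card := by
    obtain ⟨D, hD, hD'⟩ := Infinite.exists_superset_card_eq P.consts.toFinset
      (P.consts.toFinset.card + P.arity) (by omega)
    exact ⟨D, hD, by rw [Finset.card_sdiff_of_subset hD]; omega⟩
  refine ⟨∑ a ∈ Fintype.piFinset fun _ : Fin P.arity => D, K a, fun a ⟨J, hJ⟩ => ?_⟩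
  obtain ⟨π, hπ, hπ'⟩ := exists_renaming P.consts.toFinset (Finset.univ.image a) D (by
    refine le_trans (Finset.card_le_card Finset.sdiff_subset) (le_trans Finset.card_image_le ?_)
    simpa using hD')
  simp only [List.mem_toFinset] at hπ
  have hJ' := Program.answer_map (J := J.image (Fact.map π)) hπ
    (fun f => by simp [(Fact.map_injective π).eq_iff]) hJ
  obtain ⟨Pos, Neg, h₁, h₂, h₃⟩ := hK _ ⟨_, hJ'⟩
  refine ⟨Pos.image (Fact.map π.symm), Neg.image (Fact.map π.symm),
    (Finset.disjoint_image (Fact.map_injective _)).2 h₁, ?_, fun I hI hI' => ?_⟩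
  · rw [Finset.card_image_of_injective _ (Fact.map_injective _),
      Finset.card_image_of_injective _ (Fact.map_injective _)]
    refine h₂.trans (Finset.single_le_sum (f := K) (fun _ _ => Nat.zero_le _) ?_)
    rw [Fintype.mem_piFinset]
    intro i
    have := hπ' (a i) (by simp)
    rw [Finset.mem_union] at this
    exact this.elim (fun h => hD h) id
  · have h := h₃ (I.image (Fact.map π)) ?_ ?_
    · have h' := Program.answer_map (π := π.symm) (J := I)
        (fun c hc => by rw [Equiv.symm_apply_eq, hπ c hc]) (fun f => ?_) h
      · simpa using h'
      · constructor
        · intro hf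
          exact Finset.mem_image.2 ⟨_, hf, by simp⟩
        · intro hf
          obtain ⟨f', hf', rfl⟩ := Finset.mem_image.1 hf
          simpa using hf'
    · intro f hf
      exact Finset.mem_image.2 ⟨f.map π.symm, hI (Finset.mem_image_of_mem _ hf), by simp⟩
    · rw [Finset.disjoint_left] at hI' ⊢
      intro f hf hf'
      obtain ⟨f', hf₀, rfl⟩ := Finset.mem_image.1 hf'
      exact hI' (Finset.mem_image.2 ⟨f'.map π, hf, by simp⟩) hf₀

/-- If there is a repair at all, then there is one of bounded size. -/
theorem Program.exists_repair_size_le (P : Program σ) : ∃ K, ∀ (I : Instance σ)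
    (a : Fin P.arity → Dom), (∃ U, P.IsRepair I a U) → ∃ U, P.IsRepair I a U ∧ U.size ≤ K := by
  obtain ⟨K, hK⟩ := P.exists_support_card_le
  refine ⟨K, fun I a ⟨U, hU⟩ => ?_⟩
  obtain ⟨Pos, Neg, h₁, h₂, h₃⟩ := hK a ⟨_, hU.2⟩
  refine ⟨⟨Pos \ I, Neg ∩ I⟩, ⟨⟨by simp, by simp⟩, h₃ _ ?_ ?_⟩, ?_⟩
  · intro f hf
    have : f ∉ Neg := Finset.disjoint_left.1 h₁ hf
    simp only [Update.apply, Finset.mem_sdiff, Finset.mem_union, Finset.mem_inter]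
    tauto
  · rw [Finset.disjoint_left]
    intro f hf
    have : f ∉ Pos := Finset.disjoint_right.1 h₁ hf
    simp only [Update.apply, Finset.mem_sdiff, Finset.mem_union, Finset.mem_inter]
    tauto
  · refine (Finset.card_union_le _ _).trans (le_trans (Nat.add_le_add ?_ ?_) h₂)
    · exact Finset.card_le_card Finset.sdiff_subset
    · exact Finset.card_le_card Finset.inter_subset_left

end Terms

/-! ### Evaluation over a finite domain -/

section Eval

variable {σ : Schema}

/-- Ground intensional atoms. -/
abbrev IAtom : Type := Σ S : IDB, (Fin S.arity → Dom)

/-- The assignment given by a list of values for the variables `0, 1, …`. -/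
def assign (l : List Dom) : Var → Dom := fun x => l.getD x 0

/-- The head of a rule under an assignment. -/
def Rule.head (r : Rule σ) (l : List Dom) : IAtom :=
  ⟨r.headRel, fun i => assign l (r.headVars i)⟩

/-- The interpretation given by a list of ground atoms. -/
def interp (X : List IAtom) : IDBInterp := fun S v => ⟨S, v⟩ ∈ X

open Classical in
/-- The heads of the instances of rules over the domain `D` whose bodies are true. -/
noncomputable def Program.consequence (P : Program σ) (J : Instance σ) (D : List Dom)
    (X : List IAtom) : List IAtom :=
  P.rules.flatMap fun r => ((tuples D P.width).filter fun l =>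
    decide (∀ lit ∈ r.body, lit.Holds J (interp X) (assign l))).map r.head

/-- The heads of all instances of rules over the domain `D`. -/
def Program.heads (P : Program σ) (D : List Dom) : List IAtom :=
  P.rules.flatMap fun r => (tuples D P.width).map r.head

/-- The evaluation of a program over the domain `D`: the immediate consequence operator is
iterated often enough to reach its fixed point. -/
noncomputable def Program.eval (P : Program σ) (J : Instance σ) (D : List Dom) : List IAtom :=
  (P.heads D).foldl (fun X _ => P.consequence J D X) []

variable {P : Program σ} {J : Instance σ} {D : List Dom}

theorem Program.mem_consequence {X : List IAtom} {x : IAtom} :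
    x ∈ P.consequence J D X ↔ ∃ r ∈ P.rules, ∃ l ∈ tuples D P.width,
      (∀ lit ∈ r.body, lit.Holds J (interp X) (assign l)) ∧ r.head l = x := by
  simp [Program.consequence, and_assoc]

theorem Program.consequence_sublist (X : List IAtom) :
    (P.consequence J D X).Sublist (P.heads D) := by
  unfold Program.consequence Program.heads
  induction P.rules with
  | nil => simp
  | cons r l ih =>
    simp only [List.flatMap_cons]
    exact (List.filter_sublist.map _).append ih

/-- A monotone operator on lists with values in a fixed list reaches its fixed point after as many
iterations as that list is long. -/
theorem iterate_fixed {α : Type} {Φ : List α → List α} {H : List α} (hH : ∀ X, Φ X ⊆ H)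
    (hΦ : ∀ X Y, X ⊆ Y → Φ X ⊆ Φ Y) : Φ (Φ^[H.length] []) ⊆ Φ^[H.length] [] := by
  classical
  by_contra hcon
  -- otherwise, the iterates form a strictly increasing chain that is too long
  have hmono : ∀ n, Φ^[n] [] ⊆ Φ^[n + 1] [] := by
    intro n
    induction n with
    | zero => simp
    | succ n ih =>
      rw [Function.iterate_succ_apply', Function.iterate_succ_apply' _ (n + 1)]
      exact hΦ _ _ ih
  have hstep : ∀ n ≤ H.length, ¬ Φ^[n + 1] [] ⊆ Φ^[n] [] := by
    intro n hn h
    apply hcon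
    rw [← Function.iterate_succ_apply' Φ]
    obtain ⟨k, hk⟩ := Nat.exists_eq_add_of_le hn
    rw [hk]
    clear hn hk
    induction k with
    | zero => exact h
    | succ k ih =>
      have := hΦ _ _ ih
      rwa [← Function.iterate_succ_apply' Φ, ← Function.iterate_succ_apply' Φ] at this
  have hcard : ∀ n ≤ H.length + 1, n ≤ (Φ^[n] []).toFinset.card := by
    intro n hn
    induction n with
    | zero => simp
    | succ n ih =>
      refine Nat.succ_le_of_lt (lt_of_le_of_lt (ih (by omega)) (Finset.card_lt_card ?_))
      rw [Finset.ssubset_iff_subset_ne]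
      refine ⟨fun x hx => ?_, fun h => hstep n (by omega) fun x hx => ?_⟩
      · exact List.mem_toFinset.2 (hmono n (List.mem_toFinset.1 hx))
      · rw [← List.mem_toFinset, h]
        exact List.mem_toFinset.2 hx
  have h₁ := hcard _ le_rfl
  have h₂ : (Φ^[H.length + 1] []).toFinset ⊆ H.toFinset := by
    rw [Function.iterate_succ_apply']
    exact fun x hx => List.mem_toFinset.2 (hH _ (List.mem_toFinset.1 hx))
  have h₃ := (Finset.card_le_card h₂).trans (List.toFinset_card_le H)
  omega

theorem Program.consequence_mono {X Y : List IAtom} (h : X ⊆ Y) :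
    P.consequence J D X ⊆ P.consequence J D Y := by
  intro x hx
  obtain ⟨r, hr, l, hl, hb, rfl⟩ := Program.mem_consequence.1 hx
  exact Program.mem_consequence.2 ⟨r, hr, l, hl,
    fun lit hlit => (hb lit hlit).mono fun _ _ h' => h h', rfl⟩

theorem Program.consequence_eval : P.consequence J D (P.eval J D) ⊆ P.eval J D := by
  unfold Program.eval
  rw [List.foldl_const]
  exact iterate_fixed (fun X => (Program.consequence_sublist X).subset)
    fun _ _ => Program.consequence_mono

theorem Program.least_of_mem_eval {x : IAtom} (hx : x ∈ P.eval J D) : P.least J x.1 x.2 := by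
  unfold Program.eval at hx
  rw [List.foldl_const] at hx
  generalize (P.heads D).length = n at hx
  induction n generalizing x with
  | zero => simp at hx
  | succ n ih =>
    rw [Function.iterate_succ_apply'] at hx
    obtain ⟨r, hr, l, hl, hb, rfl⟩ := Program.mem_consequence.1 hx
    exact Program.least_isModel J r hr (assign l) fun lit hlit =>
      (hb lit hlit).mono fun S v h => ih h

theorem Fact.map_mem_iff {π : Equiv.Perm Dom} {B : Finset Dom} (hπ : ∀ b ∈ B, π b = b)
    (hJ : ∀ f ∈ J, ∀ i, f.2 i ∈ B) (f : Fact σ) : f.map π ∈ J ↔ f ∈ J := by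
  constructor
  · intro h
    have : f.map π = f := by
      obtain ⟨R, v⟩ := f
      simp only [Fact.map, Sigma.mk.injEq, heq_eq_eq, true_and]
      funext i
      exact π.injective (hπ _ (hJ _ h i))
    rwa [this] at h
  · intro h
    have : f.map π = f := by
      obtain ⟨R, v⟩ := f
      simp only [Fact.map, Sigma.mk.injEq, heq_eq_eq, true_and]
      funext i
      exact hπ _ (hJ _ h i)
    rwa [this]

/-- Evaluation over a finite domain finds all answers over this domain, even though variables range
over all constants, if the domain contains the constants of the program and of the instance and
enough other ones: the constants that occur in an instance of a rule can be moved into the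
domain. -/
theorem Program.mem_eval_of_mem_answer {B : Finset Dom} (hc : ∀ c ∈ P.consts, c ∈ B)
    (hJ : ∀ f ∈ J, ∀ i, f.2 i ∈ B) (hBD : B ⊆ D.toFinset)
    (hcard : 2 * P.width ≤ (D.toFinset \ B).card) {a : Fin P.arity → Dom} (haD : ∀ i, a i ∈ D)
    (ha : a ∈ P.answer J) : ⟨P.ans, a⟩ ∈ P.eval J D := by
  refine ha (fun S v => ∀ π : Equiv.Perm Dom, (∀ b ∈ B, π b = b) → (∀ i, π (v i) ∈ D) →
    (⟨S, fun i => π (v i)⟩ : IAtom) ∈ P.eval J D) ?_ (Equiv.refl _) (fun _ _ => rfl) haD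
  intro r hr g hbody π hπ hv
  -- the values of the head variables are already in `D` and have to stay fixed
  let t := Finset.univ.image fun i => π (g (r.headVars i))
  have htc : t ⊆ (Finset.range P.width).image fun x => π (g x) := by
    intro x hx
    obtain ⟨i, -, rfl⟩ := Finset.mem_image.1 hx
    exact Finset.mem_image.2 ⟨_, Finset.mem_range.2 (Program.headVars_lt_width hr i), rfl⟩
  have hcT : ((Finset.range P.width).image fun x => π (g x)).card ≤ P.width := by
    simpa using Finset.card_image_le (s := Finset.range P.width) (f := fun x => π (g x))
  obtain ⟨ρ, hρ, hρ'⟩ := exists_renaming (B ∪ t) ((Finset.range P.width).image fun x => π (g x))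
    D.toFinset (by
      have h₁ := Finset.le_card_sdiff t (D.toFinset \ B)
      rw [sdiff_sdiff_left] at h₁
      have h₂ := Finset.card_le_card htc
      have h₃ := Finset.card_le_card (Finset.sdiff_subset
        (s := (Finset.range P.width).image fun x => π (g x)) (t := B ∪ t))
      simp only [Finset.sup_eq_union] at h₁
      omega)
  have hfix : ∀ b ∈ B, (π.trans ρ) b = b := fun b hb => by
    simp [hπ b hb, hρ b (Finset.mem_union_left _ hb)]
  have hmem : ∀ x < P.width, ρ (π (g x)) ∈ D := by
    intro x hx
    have := hρ' _ (Finset.mem_image.2 ⟨x, Finset.mem_range.2 hx, rfl⟩)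
    rw [Finset.mem_union, Finset.mem_union] at this
    rcases this with (h | h) | h
    · exact List.mem_toFinset.1 (hBD h)
    · obtain ⟨i, -, h⟩ := Finset.mem_image.1 h
      rw [← h]
      exact hv i
    · exact List.mem_toFinset.1 h
  let l := (List.range P.width).map fun x => ρ (π (g x))
  have hl : ∀ x < P.width, assign l x = (π.trans ρ) (g x) := by
    intro x hx
    simp [assign, l, hx, List.getD_eq_getElem?_getD]
  have hhead : r.head l = ⟨r.headRel, fun i => π (g (r.headVars i))⟩ := by
    unfold Rule.head
    congr 1
    funext i
    rw [hl _ (Program.headVars_lt_width hr i)]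
    exact hρ _ (Finset.mem_union_right _ (Finset.mem_image.2 ⟨i, Finset.mem_univ _, rfl⟩))
  rw [← hhead]
  refine Program.consequence_eval (Program.mem_consequence.2 ⟨r, hr, l, ?_, ?_, rfl⟩)
  · rw [mem_tuples]
    refine ⟨by simp [l], fun x hx => ?_⟩
    obtain ⟨y, hy, rfl⟩ := List.mem_map.1 hx
    exact hmem y (List.mem_range.1 hy)
  · intro lit hlit
    have hterm := fun {u} => Program.mem_terms_of_mem_body (t := u) hr hlit
    refine (hbody lit hlit).map (π.trans ρ)
      (fun c h => hfix _ (hc _ (Program.mem_consts (hterm h))))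
      (fun x h => hl x (Program.lt_width (hterm h))) (Fact.map_mem_iff hfix hJ) ?_
    intro S v hv' h
    refine h _ hfix fun i => ?_
    obtain ⟨u, hu, hvi⟩ := hv' i
    rw [hvi]
    cases u with
    | var x => exact hmem x (Program.lt_width (hterm hu))
    | const c =>
      have hcB := hc _ (Program.mem_consts (hterm hu))
      exact (hfix c hcB).symm ▸ List.mem_toFinset.1 (hBD hcB)

/-! ### The search for a repair -/

/-- The positive number with the binary digits `0, …, 0, 1`, the least significant one first. -/
def powNum : ℕ → PosNum
  | 0 => .one
  | n + 1 => .bit0 (powNum n)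

/-- A constant whose encoding consists of `n + 1` digits. -/
def longConst (n : ℕ) : Dom := (Num.pos (powNum n) : Num)

theorem encodeNat_longConst (n : ℕ) :
    Computability.encodeNat (longConst n) = List.replicate n false ++ [true] := by
  rw [longConst, Computability.encodeNat, Num.of_to_nat]
  induction n with
  | zero => rfl
  | succ n ih => exact congrArg _ ih

/-- Some constants that do not occur in a list of constants, because their encodings are longer. -/
def freshConsts (N : ℕ) (B : List Dom) : List Dom :=
  (List.range N).map fun j => longConst ((B.flatMap Computability.encodeNat).length + j)

theorem not_mem_of_mem_freshConsts {N : ℕ} {B : List Dom} {d : Dom} (hd : d ∈ freshConsts N B) :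
    d ∉ B := by
  intro h
  obtain ⟨j, -, rfl⟩ := List.mem_map.1 hd
  have := (List.sublist_flatten_of_mem (List.mem_map.2 ⟨_, h, rfl⟩ :
    _ ∈ B.map Computability.encodeNat)).length_le
  rw [encodeNat_longConst, ← List.flatMap_def] at this
  simp at this

theorem card_freshConsts (N : ℕ) (B : List Dom) : (freshConsts N B).toFinset.card = N := by
  rw [List.toFinset_card_of_nodup]
  · simp [freshConsts]
  · refine List.Nodup.map (fun i j h => ?_) List.nodup_range
    have := congrArg (fun n => (Computability.encodeNat n).length) h
    simpa [encodeNat_longConst] using this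

/-- The constants that occur in a list of facts, in a tuple, or in the program. -/
def Program.knownConsts (P : Program σ) (x : List (Fact σ) × (Fin P.arity → Dom)) : List Dom :=
  x.1.flatMap (fun f => List.ofFn f.2) ++ (List.ofFn x.2 ++ P.consts)

/-- The known constants together with `N` fresh ones. -/
def Program.domain (P : Program σ) (N : ℕ) (x : List (Fact σ) × (Fin P.arity → Dom)) : List Dom :=
  P.knownConsts x ++ freshConsts N (P.knownConsts x)

/-- The fact with a given list of arguments. -/
def factOf (R : σ.Rel) (t : List Dom) : Fact σ := ⟨R, fun i => t.getD i 0⟩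

variable (σ) in
/-- All facts over a domain. -/
noncomputable def factsOver (D : List Dom) : List (Fact σ) :=
  (Finset.univ : Finset σ.Rel).toList.flatMap fun R => (tuples D (σ.arity R)).map (factOf R)

theorem mem_factsOver {f : Fact σ} (hf : ∀ i, f.2 i ∈ D) : f ∈ factsOver σ D := by
  simp only [factsOver, List.mem_flatMap, List.mem_map]
  refine ⟨f.1, by simp, List.ofFn f.2, mem_tuples.2 ⟨by simp, fun a ha => ?_⟩, ?_⟩
  · obtain ⟨i, rfl⟩ := (List.mem_ofFn' _ _).1 ha
    exact hf i
  · simp [factOf, List.getD_eq_getElem?_getD]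

/-- All lists of at most `K` facts over a domain, the shorter ones first. -/
noncomputable def candidates (σ : Schema) (K : ℕ) (D : List Dom) : List (List (Fact σ)) :=
  (List.range (K + 1)).flatMap fun j => tuples (factsOver σ D) j

theorem pairwise_candidates (K : ℕ) (D : List Dom) :
    (candidates σ K D).Pairwise fun F F' => F.length ≤ F'.length := by
  rw [candidates, List.pairwise_flatMap]
  refine ⟨fun j _ => ?_, List.pairwise_lt_range.imp fun {i j} hij F hF F' hF' => ?_⟩
  · exact List.pairwise_of_forall_mem_list fun F hF F' hF' =>
      ((mem_tuples.1 hF).1.trans (mem_tuples.1 hF').1.symm).le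
  · rw [(mem_tuples.1 hF).1, (mem_tuples.1 hF').1]
    exact hij.le

/-- The instance that results if the facts in `F` change their membership in `L`. -/
def toggle (L F : List (Fact σ)) : Instance σ := symmDiff L.toFinset F.toFinset

/-- Changing the membership of the facts in `F` makes the tuple an answer. -/
def Program.IsSolution (P : Program σ) (N : ℕ) (x : List (Fact σ) × (Fin P.arity → Dom))
    (F : List (Fact σ)) : Prop :=
  (⟨P.ans, x.2⟩ : IAtom) ∈ P.eval (toggle x.1 F) (P.domain N x)

open Classical in
/-- The lists of facts that lead to a repair when their membership is changed. -/
noncomputable def Program.solutions (P : Program σ) (K N : ℕ)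
    (x : List (Fact σ) × (Fin P.arity → Dom)) : List (List (Fact σ)) :=
  (candidates σ K (P.domain N x)).filter fun F => decide (P.IsSolution N x F)

/-- The changes of membership, split into insertions and deletions. -/
def splitChanges (L F : List (Fact σ)) : List (Fact σ) × List (Fact σ) :=
  (F.filter fun f => decide (f ∉ L), F.filter fun f => decide (f ∈ L))

/-- The repair that is given by the first solution. -/
noncomputable def Program.solve (P : Program σ) (K N : ℕ)
    (x : List (Fact σ) × (Fin P.arity → Dom)) : Option (List (Fact σ) × List (Fact σ)) :=
  (P.solutions K N x).head?.map (splitChanges x.1)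

theorem Program.isRepair_of_mem_solutions {K N : ℕ} {x : List (Fact σ) × (Fin P.arity → Dom)}
    {F : List (Fact σ)} (hF : F ∈ P.solutions K N x) :
    P.IsRepair x.1.toFinset x.2 (.ofLists (splitChanges x.1 F)) := by
  have h : x.2 ∈ P.answer (toggle x.1 F) := by
    simp only [Program.solutions, List.mem_filter, decide_eq_true_eq] at hF
    exact Program.least_of_mem_eval hF.2
  refine ⟨⟨by simp [Update.ofLists, splitChanges], fun f => ?_⟩, ?_⟩
  · simp [Update.ofLists, splitChanges]
  · have he : (Update.ofLists (splitChanges x.1 F)).apply x.1.toFinset = toggle x.1 F := by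
      ext f
      simp [Update.ofLists, Update.apply, splitChanges, toggle, Finset.mem_symmDiff]
      tauto
    rwa [he]

theorem size_splitChanges_le (L F : List (Fact σ)) :
    (Update.ofLists (splitChanges L F)).size ≤ F.length := by
  refine le_trans (Finset.card_le_card (t := F.toFinset) fun f hf => ?_) (List.toFinset_card_le F)
  simp only [Update.ofLists, splitChanges, Finset.mem_union, List.mem_toFinset,
    List.mem_filter] at hf
  exact List.mem_toFinset.2 (hf.elim And.left And.left)

/-- Every small repair corresponds to a solution of the same size, after its constants have been
moved into the domain. -/
theorem Program.exists_mem_solutions {K N : ℕ}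
    (hN : N = K * Finset.univ.sup σ.arity + 2 * P.width)
    {x : List (Fact σ) × (Fin P.arity → Dom)} {U : Update σ} (hU : P.IsRepair x.1.toFinset x.2 U)
    (hK : U.size ≤ K) : ∃ F ∈ P.solutions K N x, F.length = U.size := by
  let B := (P.knownConsts x).toFinset
  let D := P.domain N x
  let V := (U.ins ∪ U.del).biUnion fun f => Finset.univ.image f.2
  have hV : V.card ≤ K * Finset.univ.sup σ.arity := by
    refine (Finset.card_biUnion_le_card_mul _ _ (Finset.univ.sup σ.arity) fun f _ => ?_).trans
      (Nat.mul_le_mul_right _ hK)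
    refine Finset.card_image_le.trans ?_
    simpa using Finset.le_sup (f := σ.arity) (Finset.mem_univ f.1)
  have hBD : B ⊆ D.toFinset := fun b hb => by
    simp only [B, D, Program.domain, List.mem_toFinset, List.mem_append] at hb ⊢
    exact .inl hb
  have hDB : N ≤ (D.toFinset \ B).card := by
    rw [← card_freshConsts N (P.knownConsts x)]
    refine Finset.card_le_card fun d hd => ?_
    rw [List.mem_toFinset] at hd
    simp only [B, D, Program.domain, List.mem_toFinset, List.mem_append, Finset.mem_sdiff]
    exact ⟨.inr hd, not_mem_of_mem_freshConsts hd⟩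
  obtain ⟨π, hπ, hπV⟩ := exists_renaming B V D.toFinset
    ((Finset.card_le_card Finset.sdiff_subset).trans (hV.trans (le_trans (by omega) hDB)))
  rw [Finset.union_eq_right.2 hBD] at hπV
  have hB : ∀ f ∈ x.1.toFinset, ∀ i, f.2 i ∈ B := by
    intro f hf i
    simp only [B, Program.knownConsts, List.mem_toFinset, List.mem_append, List.mem_flatMap] at hf ⊢
    exact .inl ⟨f, hf, by simp⟩
  have hBa : ∀ i, x.2 i ∈ B := by
    intro i
    simp [B, Program.knownConsts]
  have hBc : ∀ c ∈ P.consts, c ∈ B := by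
    intro c hc
    simp [B, Program.knownConsts, hc]
  -- the renamed repair, as a list of facts over `D`
  let F := ((U.ins ∪ U.del).image (Fact.map π)).toList
  have hF : ∀ f : Fact σ, f ∈ F.toFinset ↔ ∃ f' ∈ U.ins ∪ U.del, f'.map π = f := by
    intro f
    rw [List.mem_toFinset, Finset.mem_toList, Finset.mem_image]
  have hFD : ∀ f ∈ F.toFinset, ∀ i, f.2 i ∈ V.image π := by
    intro f hf i
    obtain ⟨f', hf', rfl⟩ := (hF f).1 hf
    refine Finset.mem_image.2 ⟨f'.2 i, Finset.mem_biUnion.2 ⟨f', hf', ?_⟩, rfl⟩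
    exact Finset.mem_image.2 ⟨i, Finset.mem_univ _, rfl⟩
  have hVD : V.image π ⊆ D.toFinset := Finset.image_subset_iff.2 hπV
  have hFl : F.length = U.size := by
    rw [Finset.length_toList, Finset.card_image_of_injective _ (Fact.map_injective π)]
    rfl
  refine ⟨F, ?_, hFl⟩
  simp only [Program.solutions, List.mem_filter, decide_eq_true_eq]
  constructor
  · refine List.mem_flatMap.2 ⟨F.length, List.mem_range.2 (by omega), mem_tuples.2 ⟨rfl, ?_⟩⟩
    exact fun f hf => mem_factsOver fun i =>
      List.mem_toFinset.1 (hVD (hFD f (List.mem_toFinset.2 hf) i))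
  -- of the fresh constants, at least `2 * P.width` are not used by the renamed repair
  · refine Program.mem_eval_of_mem_answer (B := B ∪ V.image π)
      (fun c hc => Finset.mem_union_left _ (hBc c hc)) ?_ (Finset.union_subset hBD hVD) ?_
      (fun i => List.mem_toFinset.1 (hBD (hBa i))) ?_
    · intro f hf i
      rw [toggle, Finset.mem_symmDiff] at hf
      rcases hf with ⟨hf, -⟩ | ⟨hf, -⟩
      · exact Finset.mem_union_left _ (hB f hf i)
      · exact Finset.mem_union_right _ (hFD f hf i)
    · have h₁ := Finset.le_card_sdiff (V.image π) (D.toFinset \ B)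
      rw [sdiff_sdiff_left] at h₁
      have h₂ := Finset.card_image_le (s := V) (f := π)
      simp only [Finset.sup_eq_union] at h₁
      omega
    · have h := Program.answer_map (π := π) (J := toggle x.1 F)
        (fun c hc => hπ c (hBc c hc)) ?_ hU.2
      · convert h using 1
        funext i
        exact (hπ _ (hBa i)).symm
      · intro f
        have h₁ := Fact.map_mem_iff hπ hB f
        have h₂ : f.map π ∈ F.toFinset ↔ f ∈ U.ins ∪ U.del := by
          rw [hF]
          constructor
          · rintro ⟨f', hf', h⟩
            rwa [← Fact.map_injective π h]
          · exact fun h => ⟨f, h, rfl⟩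
        rw [toggle, Finset.mem_symmDiff, h₁, h₂, Update.apply, Finset.mem_sdiff, Finset.mem_union,
          Finset.mem_union]
        have h₃ := hU.1.1 f
        have h₄ := @hU.1.2 f
        tauto

/-- With suitable parameters, the search outputs a minimum repair, if there is a repair. -/
theorem Program.exists_solve_correct (P : Program σ) : ∃ K N, ∀ (L : List (Fact σ))
    (a : Fin P.arity → Dom),
    P.IsMAMinOutput L.toFinset a ((P.solve K N (L, a)).map Update.ofLists) := by
  obtain ⟨K, hK⟩ := P.exists_repair_size_le
  refine ⟨K, K * Finset.univ.sup σ.arity + 2 * P.width, fun L a => ?_⟩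
  have hex := fun {U} => Program.exists_mem_solutions (P := P) (K := K) rfl (x := (L, a)) (U := U)
  generalize K * Finset.univ.sup σ.arity + 2 * P.width = N at hex
  rw [Program.solve]
  have hsound := fun {F} => Program.isRepair_of_mem_solutions (P := P) (K := K) (N := N)
    (x := (L, a)) (F := F)
  have hpair : (P.solutions K N (L, a)).Pairwise fun F F' => F.length ≤ F'.length :=
    (pairwise_candidates K _).filter _
  generalize P.solutions K N (L, a) = s at hex hsound hpair
  cases s with
  | nil =>
    intro U hU
    obtain ⟨U', hU', hle⟩ := hK _ _ ⟨U, hU⟩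
    obtain ⟨F, hF, -⟩ := hex hU' hle
    simp at hF
  | cons F s =>
    refine ⟨hsound (List.mem_cons_self ..), fun U hU => ?_⟩
    refine (size_splitChanges_le _ _).trans ?_
    suffices h : ∃ U', U'.size ≤ U.size ∧ P.IsRepair L.toFinset a U' ∧ U'.size ≤ K by
      obtain ⟨U', h₁, h₂, h₃⟩ := h
      obtain ⟨F', hF', hl⟩ := hex h₂ h₃
      refine le_trans ?_ (hl.trans_le h₁)
      rcases List.mem_cons.1 hF' with rfl | hF'
      · rfl
      · exact (List.pairwise_cons.1 hpair).1 _ hF'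
    by_cases hle : U.size ≤ K
    · exact ⟨U, le_rfl, hU, hle⟩
    · obtain ⟨U', hU', h⟩ := hK _ _ ⟨U, hU⟩
      exact ⟨U', by omega, hU', h⟩

end Eval

/-! ### The search runs in polynomial time -/

/-- Unary numerals as trees. -/
def unary : ℕ → BTree
  | 0 => .nil
  | n + 1 => .node .nil (unary n)

theorem unary_injective : Function.Injective unary := by
  intro m
  induction m with
  | zero => intro n h; cases n <;> simp_all [unary]
  | succ m ih =>
    intro n h
    cases n with
    | zero => simp [unary] at h
    | succ n => rw [ih (BTree.node.inj h).2]

/-- The elements of a finite type are encoded by unary numerals. -/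
noncomputable abbrev Coded.ofFintype (α : Type) [Fintype α] : Coded α where
  code a := unary (Fintype.equivFin α a)
  code_injective := unary_injective.comp
    (Fin.val_injective.comp (Fintype.equivFin α).injective)

section

variable {σ : Schema}

instance : Finite (Letter σ) :=
  .of_injective (β := Bool ⊕ Option (Option σ.Rel))
    (fun | .bit b => .inl b | .endConst => .inr none | .sep => .inr (some none)
         | .rel R => .inr (some (some R))) (by
      intro a b h
      cases a <;> cases b <;> simp_all)

noncomputable instance : Fintype (Letter σ) := Fintype.ofFinite _

noncomputable instance : Coded (Letter σ) := .ofFintype _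

noncomputable instance : Coded σ.Rel := .ofFintype _

/-- A fact is encoded as a pair of its symbol and its tuple. -/
noncomputable instance : Coded (Fact σ) where
  code f := Coded.code (f.1, List.ofFn f.2)
  code_injective := by
    rintro ⟨R, v⟩ ⟨R', v'⟩ h
    have h' := Coded.code_injective h
    simp only [Prod.mk.injEq] at h'
    obtain ⟨rfl, h'⟩ := h'
    rw [List.ofFn_injective h']

/-- A ground intensional atom is encoded as a list of numbers. -/
instance : Coded IAtom where
  code x := Coded.code (x.1.arity :: x.1.name :: List.ofFn x.2)
  code_injective := by
    rintro ⟨⟨n, k⟩, v⟩ ⟨⟨n', k'⟩, v'⟩ h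
    have h' := Coded.code_injective h
    simp only [List.cons.injEq] at h'
    obtain ⟨rfl, rfl, h'⟩ := h'
    rw [List.ofFn_injective h']

variable {γ : Type} [Coded γ] {P : Program σ}

namespace PT

theorem encodeNat {f : γ → ℕ} (hf : PT σ f) : PT σ (fun c => Computability.encodeNat (f c)) :=
  hf.of_code _ id (fun _ => rfl) (fun _ => rfl)

theorem fact (R : σ.Rel) {f : γ → Fin (σ.arity R) → Dom} (hf : ∀ i, PT σ (fun c => f c i)) :
    PT σ (fun c => (⟨R, fun i => f c i⟩ : Fact σ)) :=
  ((const R).pair (ofFn.comp (tuple hf))).of_code _ id (fun _ => rfl) (fun _ => rfl)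

theorem factRel {f : γ → Fact σ} (hf : PT σ f) : PT σ (fun c => (f c).1) :=
  fst.comp (hf.of_code (fun c => ((f c).1, List.ofFn (f c).2)) id (fun _ => rfl) (fun _ => rfl))

theorem factArgs {f : γ → Fact σ} (hf : PT σ f) : PT σ (fun c => List.ofFn (f c).2) :=
  snd.comp (hf.of_code (fun c => ((f c).1, List.ofFn (f c).2)) id (fun _ => rfl) (fun _ => rfl))

theorem iatom (S : IDB) {f : γ → Fin S.arity → Dom} (hf : ∀ i, PT σ (fun c => f c i)) :
    PT σ (fun c => (⟨S, fun i => f c i⟩ : IAtom)) :=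
  ((const S.arity).cons ((const S.name).cons (ofFn.comp (tuple hf)))).of_code _ id
    (fun _ => rfl) (fun _ => rfl)

theorem termVal {l : γ → List Dom} (hl : PT σ l) (t : Term) :
    PT σ (fun c => t.val (assign (l c))) := by
  cases t with
  | var x => exact hl.getD x 0
  | const d => exact const d

theorem head {l : γ → List Dom} (hl : PT σ l) (r : Rule σ) : PT σ (fun c => r.head (l c)) :=
  iatom _ fun i => hl.getD (r.headVars i) 0

end PT

namespace PTPred

variable {L F : γ → List (Fact σ)} {X : γ → List IAtom} {l D : γ → List Dom}

theorem mem_toggle (hL : PT σ L) (hF : PT σ F) {f : γ → Fact σ} (hf : PT σ f) :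
    PTPred σ (fun c => f c ∈ toggle (L c) (F c)) :=
  (((mem hf hL).and (mem hf hF).not).or ((mem hf hF).and (mem hf hL).not)).of_iff
    fun c => by simp [toggle, Finset.mem_symmDiff]

theorem holds (hL : PT σ L) (hF : PT σ F) (hX : PT σ X) (hl : PT σ l) (lit : Literal σ) :
    PTPred σ (fun c => lit.Holds (toggle (L c) (F c)) (interp (X c)) (assign (l c))) := by
  cases lit with
  | edb R t => exact mem_toggle hL hF (PT.fact R fun i => PT.termVal hl (t i))
  | idb S t => exact mem (PT.iatom S fun i => PT.termVal hl (t i)) hX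
  | eq s t => exact eq (PT.termVal hl s) (PT.termVal hl t)
  | notEdb R t => exact (mem_toggle hL hF (PT.fact R fun i => PT.termVal hl (t i))).not
  | ne s t => exact (eq (PT.termVal hl s) (PT.termVal hl t)).not

end PTPred

namespace PT

variable {L F : γ → List (Fact σ)} {X : γ → List IAtom} {D : γ → List Dom}

theorem consequence (hL : PT σ L) (hF : PT σ F) (hD : PT σ D) (hX : PT σ X) :
    PT σ (fun c => P.consequence (toggle (L c) (F c)) (D c) (X c)) := by
  unfold Program.consequence
  refine flatMap_const P.rules fun r _ => ?_
  refine map (f := fun _ l => r.head l) ?_ (head snd r)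
  classical
  refine filter (P := fun c l => ∀ lit ∈ r.body,
    lit.Holds (toggle (L c) (F c)) (interp (X c)) (assign l)) (hD.tuples P.width) ?_
  exact PTPred.forall_const r.body fun lit _ =>
    PTPred.holds (hL.comp fst) (hF.comp fst) (hX.comp fst) snd lit

theorem heads (hD : PT σ D) : PT σ (fun c => P.heads (D c)) :=
  flatMap_const P.rules (f := fun r c => (SPDatalog.tuples (D c) P.width).map r.head) fun r _ =>
    map (f := fun _ l => r.head l) (hD.tuples P.width) (head snd r)

theorem eval (hL : PT σ L) (hF : PT σ F) (hD : PT σ D) :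
    PT σ (fun c => P.eval (toggle (L c) (F c)) (D c)) := by
  obtain ⟨q, hq⟩ := (heads (P := P) hD).sz_le
  refine foldl (g := fun c X _ => P.consequence (toggle (L c) (F c)) (D c) X) (heads hD) (const [])
    (consequence (hL.comp fst) (hF.comp fst) (hD.comp fst) (fst.comp snd))
    ⟨q, fun c s x => ?_⟩
  have h₁ := sz_le_of_sublist (Program.consequence_sublist (P := P)
    (J := toggle (L c) (F c)) (D := D c) s)
  have h₂ := eval_mono q (Nat.le_add_right (sz c) (sz x))
  have := hq c
  omega

theorem longConst {B : γ → List Dom} (hB : PT σ B) (j : ℕ) :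
    PT σ (fun c => longConst (((B c).flatMap Computability.encodeNat).length + j)) := by
  have h : PT σ (fun c => ((B c).flatMap Computability.encodeNat).map (fun _ => false) ++
      (List.replicate j false ++ [true])) :=
    ((hB.flatMap (f := fun _ n => Computability.encodeNat n) snd.encodeNat).map
      (f := fun _ _ => false) (const _)).append (const _)
  refine h.of_code _ id (fun _ => rfl) fun c => ?_
  change _ = Coded.code (Computability.encodeNat _)
  rw [encodeNat_longConst, List.replicate_add, List.append_assoc, List.map_const']
  rfl

theorem domain (N : ℕ) : PT σ (fun x : List (Fact σ) × (Fin P.arity → Dom) => P.domain N x) := by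
  have h : PT σ (fun x : List (Fact σ) × (Fin P.arity → Dom) => P.knownConsts x) :=
    ((fst (α := List (Fact σ)) (β := Fin P.arity → Dom)).flatMap
      (f := fun _ (f : Fact σ) => List.ofFn f.2) (factArgs snd)).append
      ((ofFn.comp snd).append (const P.consts))
  exact h.append (map_const _ fun j _ => longConst h j)

theorem factsOver (hD : PT σ D) : PT σ (fun c => factsOver σ (D c)) := by
  have h := fun R : σ.Rel => fact (σ := σ) R (γ := γ × List Dom)
    (f := fun p i => p.2.getD i 0) fun i => snd.getD i 0
  have h' := fun R : σ.Rel => map (f := fun _ t => factOf R t) (hD.tuples (σ.arity R)) (h R)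
  exact flatMap_const (Finset.univ : Finset σ.Rel).toList fun R _ => h' R

theorem solutions (K N : ℕ) :
    PT σ (fun x : List (Fact σ) × (Fin P.arity → Dom) => P.solutions K N x) := by
  classical
  refine filter (P := fun x F => P.IsSolution N x F) ?_ ?_
  · exact flatMap_const _ (f := fun j (x : List (Fact σ) × (Fin P.arity → Dom)) =>
      SPDatalog.tuples (SPDatalog.factsOver σ (P.domain N x)) j)
      fun j _ => (factsOver (domain N)).tuples j
  · refine PTPred.mem ?_ (eval (fst.comp fst) snd ((domain N).comp fst))
    refine ((const P.ans.arity).cons ((const P.ans.name).cons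
      (ofFn.comp (snd.comp fst)))).of_code _ id (fun _ => rfl) (fun _ => rfl)

theorem encodeFacts (hL : PT σ L) : PT σ (fun c => encodeFacts (L c)) := by
  refine hL.flatMap (f := fun _ f => encodeFact f) ?_
  refine cons ((of_finite Letter.rel).comp (factRel snd)) ?_
  refine flatMap (f := fun _ d => encodeConst σ d) (factArgs snd) ?_
  exact (map (f := fun _ b => Letter.bit b) (encodeNat snd)
    ((of_finite Letter.bit).comp snd)).append (const _)

theorem solve (K N : ℕ) :
    PT σ (fun x : List (Fact σ) × (Fin P.arity → Dom) => encodeOutput (P.solve K N x)) := by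
  refine listCases (solutions K N)
    (F := fun x s => encodeOutput (s.head?.map (splitChanges x.1))) (const []) ?_
  have hL : PT σ (fun p : (List (Fact σ) × List (List (Fact σ))) ×
      (List (Fact σ) × (Fin P.arity → Dom)) => p.2.1) := fst.comp snd
  have hF : PT σ (fun p : (List (Fact σ) × List (List (Fact σ))) ×
      (List (Fact σ) × (Fin P.arity → Dom)) => p.1.1) := fst.comp fst
  have hm := PTPred.mem (σ := σ) (snd (σ := σ)) (hL.comp (fst (β := Fact σ)))
  exact (encodeFacts (hF.filter (P := fun p f => f ∉ p.2.1) hm.not)).append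
    ((const _).cons (encodeFacts (hF.filter (P := fun p f => f ∈ p.2.1) hm)))

end PT

/-! ### Reading the input -/

/-- The state of the parser: the constants read since the last symbol, the tuple, and the facts;
constants are represented by their digits. -/
abbrev ParseState (σ : Schema) : Type :=
  List (List Bool) × List (List Bool) × List (σ.Rel × List (List Bool))

/-- The step of the parser, which reads the input from right to left. -/
def parseStep (s : ParseState σ) : Letter σ → ParseState σ
  | .bit b => ((b :: s.1.headD []) :: s.1.tail, s.2.1, s.2.2)
  | .endConst => ([] :: s.1, s.2.1, s.2.2)
  | .rel R => ([], s.2.1, (R, s.1) :: s.2.2)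
  | .sep => ([], s.1, s.2.2)

section

variable (s : ParseState σ)

@[simp] theorem parseStep_bit (b : Bool) :
    parseStep s (.bit b) = ((b :: s.1.headD []) :: s.1.tail, s.2.1, s.2.2) := rfl

@[simp] theorem parseStep_endConst : parseStep s .endConst = ([] :: s.1, s.2.1, s.2.2) := rfl

@[simp] theorem parseStep_rel (R : σ.Rel) :
    parseStep s (.rel R) = ([], s.2.1, (R, s.1) :: s.2.2) := rfl

@[simp] theorem parseStep_sep : parseStep s .sep = ([], s.1, s.2.2) := rfl

end

/-- The parser, applied to the reversed input. -/
def parse (w : List (Letter σ)) : List (σ.Rel × List (List Bool)) × List (List Bool) :=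
  ((w.foldl parseStep ([], [], [])).2.2, (w.foldl parseStep ([], [], [])).2.1)

theorem foldr_encodeConst (d : Dom) (s : ParseState σ) :
    (encodeConst σ d).foldr (fun x s => parseStep s x) s =
      (Computability.encodeNat d :: s.1, s.2.1, s.2.2) := by
  have h : ∀ b : List Bool, (b.map Letter.bit).foldr (fun (x : Letter σ) s => parseStep s x)
      ([] :: s.1, s.2.1, s.2.2) = (b :: s.1, s.2.1, s.2.2) := by
    intro b
    induction b with
    | nil => rfl
    | cons x b ih => rw [List.map_cons, List.foldr_cons, ih]; simp
  simpa [encodeConst] using h _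

theorem foldr_encodeTuple (l : List Dom) (s : ParseState σ) :
    (l.flatMap (encodeConst σ)).foldr (fun x s => parseStep s x) s =
      (l.map Computability.encodeNat ++ s.1, s.2.1, s.2.2) := by
  induction l with
  | nil => rfl
  | cons d l ih => simp [foldr_encodeConst, ih]

theorem foldr_encodeFacts (L : List (Fact σ)) (t : List (List Bool)) :
    (encodeFacts L).foldr (fun x s => parseStep s x) ([], t, []) =
      ([], t, L.map fun f => (f.1, (List.ofFn f.2).map Computability.encodeNat)) := by
  induction L with
  | nil => rfl
  | cons f L ih =>
    simp only [encodeFacts] at ih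
    simp only [encodeFacts, List.flatMap_cons, List.foldr_append, ih]
    simp [encodeFact, encodeTuple, foldr_encodeTuple]

theorem code_map_encodeNat (l : List ℕ) :
    Coded.code (l.map Computability.encodeNat) = Coded.code l := by
  induction l with
  | nil => rfl
  | cons n l ih => exact congrArg (BTree.node _) ih

/-- The result of the parser has the same encoding as the input that it has read. -/
theorem code_parse {k : ℕ} (x : List (Fact σ) × (Fin k → Dom)) :
    Coded.code (parse (encodeInput x).reverse) = Coded.code x := by
  have h : parse (encodeInput x).reverse =
      (x.1.map fun f => (f.1, (List.ofFn f.2).map Computability.encodeNat),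
        (List.ofFn x.2).map Computability.encodeNat) := by
    simp [parse, encodeInput, List.foldl_reverse, encodeTuple, foldr_encodeTuple,
      foldr_encodeFacts]
  rw [h]
  refine congrArg₂ BTree.node ?_ (code_map_encodeNat _)
  induction x.1 with
  | nil => rfl
  | cons f L ih => exact congrArg₂ BTree.node (congrArg _ (code_map_encodeNat _)) ih

theorem PT.parse : PT σ (SPDatalog.parse (σ := σ)) := by
  suffices h : PT σ (fun w : List (Letter σ) => w.foldl parseStep ([], [], [])) from
    (snd.comp (snd.comp h)).pair (fst.comp (snd.comp h))
  have hstep : PT σ (fun p : Letter σ × ParseState σ => parseStep p.2 p.1) := by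
    refine finCases (f := fun x s => parseStep s x) fun x => ?_
    cases x with
    | bit b => exact (((const b).cons (fst.headD [])).cons fst.tail).pair snd
    | endConst => exact ((const []).cons fst).pair snd
    | rel R =>
      exact (const []).pair ((fst.comp snd).pair (((const R).pair fst).cons (snd.comp snd)))
    | sep => exact (const []).pair (fst.pair (snd.comp snd))
  obtain ⟨M, hM⟩ : ∃ M, ∀ R : σ.Rel, sz R ≤ M :=
    ⟨Finset.univ.sup sz, fun R => Finset.le_sup (f := sz) (Finset.mem_univ R)⟩
  refine foldl (γ := List (Letter σ)) PT.id (const _) (g := fun _ s x => parseStep s x)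
    (hstep.comp ((snd.comp snd).pair (fst.comp snd))) ⟨C (M + 9), fun c s x => ?_⟩
  obtain ⟨cur, t, fs⟩ := s
  have hbool : ∀ b : Bool, sz b ≤ 3 := fun b => by cases b <;> simp [sz, Coded.code, BTree.size]
  cases x with
  | bit b =>
    have := hbool b
    cases cur <;> simp <;> omega
  | endConst => simp; omega
  | rel R =>
    have := hM R
    simp; omega
  | sep => simp; omega

end

/-! ### The Turing machine -/

section

variable {σ : Schema}

namespace Cmd

/-- Turn the input on `aux` into an encoded list on the main stack, in reverse order. -/
noncomputable def readInput (σ : Schema) : Prog σ :=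
  (push .main .sep).seq (forSymbols .aux fun s =>
    (PT.pushWord ((Coded.code s).word σ)).seq (push .main .endConst))

theorem within_readInput {M : ℕ} (hM : ∀ s : Letter σ, sz s ≤ M) (w : List (Letter σ)) :
    (readInput σ).Within (regs [] w [] []) (regs ((Coded.code w.reverse).word σ) [] [] [])
      (w.length * (M + 5) + 2) := by
  suffices h : ∀ v : List (Letter σ),
      (forSymbols .aux fun s : Letter σ =>
        (PT.pushWord ((Coded.code s).word σ)).seq (push .main .endConst)).Within
        (regs ((Coded.code v).word σ) w [] [])
        (regs ((Coded.code (w.reverse ++ v)).word σ) [] [] []) (w.length * (M + 5) + 1) by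
    have h' := h []
    rw [List.append_nil] at h'
    exact (Within.push_main.seq h').mono (by omega)
  induction w with
  | nil => exact fun v => (forSymbols_nil rfl).mono (by simp)
  | cons s w ih =>
    intro v
    have h := ih (s :: v)
    rw [show w.reverse ++ s :: v = (s :: w).reverse ++ v by simp] at h
    refine (forSymbols_cons (n := M + 2) rfl ?_ h).mono (by simp; ring_nf; omega)
    rw [update_regs_aux]
    refine ((PT.within_pushWord _ _).seq Within.push_main).mono ?_
    have := hM s
    simp [sz] at *
    omega

/-- Replace the unary numeral on top of the main stack by the symbol with that index in a list,
which is pushed on `out`. -/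
def decodeLetter : List (Letter σ) → Prog σ
  | [] => skip
  | s :: l => branch .main fun
    | some .endConst => (pop .main).seq ((pop .main).seq (decodeLetter l))
    | _ => (pop .main).seq (push .out s)

theorem within_decodeLetter {l : List (Letter σ)} {i : ℕ} (hi : i < l.length)
    {m o : List (Letter σ)} :
    (decodeLetter l).Within (regs ((unary i).word σ ++ m) [] o []) (regs m [] (l[i] :: o) [])
      (3 * l.length) := by
  induction l generalizing i with
  | nil => simp at hi
  | cons s l ih =>
    cases i with
    | zero =>
      exact (Within.branch (n := 2) (Within.pop_main.seq Within.push_out)).mono (by simp)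
    | succ i =>
      exact (Within.branch (n := 1 + (1 + 3 * l.length))
        (Within.pop_main.seq (Within.pop_main.seq (ih (Nat.lt_of_succ_lt_succ hi))))).mono
        (by simp; omega)

/-- The alphabet, in the order that underlies the encoding of symbols. -/
noncomputable def alphabet (σ : Schema) : List (Letter σ) :=
  List.ofFn (Fintype.equivFin (Letter σ)).symm

/-- Turn an encoded list on the main stack into the output, in reverse order. -/
noncomputable def writeOutput (σ : Schema) : Prog σ :=
  (loop .main (fun | some .endConst => true | _ => false)
    ((pop .main).seq (decodeLetter (alphabet σ)))).seq (pop .main)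

theorem within_writeOutput (w : List (Letter σ)) :
    (writeOutput σ).Within (regs ((Coded.code w).word σ) [] [] []) (regs [] [] w.reverse [])
      (w.length * (3 * (alphabet σ).length + 2) + 2) := by
  suffices h : ∀ o : List (Letter σ), (loop .main (fun | some .endConst => true | _ => false)
      ((pop .main).seq (decodeLetter (alphabet σ)))).Within
      (regs ((Coded.code w).word σ) [] o []) (regs [.sep] [] (w.reverse ++ o) [])
      (w.length * (3 * (alphabet σ).length + 2) + 1) by
    have h' := h []
    rw [List.append_nil] at h'
    exact h'.seq Within.pop_main
  induction w with
  | nil => exact fun o => (Within.finish rfl).mono (by simp)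
  | cons s w ih =>
    intro o
    have h := ih (s :: o)
    rw [show w.reverse ++ s :: o = (s :: w).reverse ++ o by simp] at h
    have hi : (Fintype.equivFin (Letter σ) s : ℕ) < (alphabet σ).length := by simp [alphabet]
    have hs : (alphabet σ)[(Fintype.equivFin (Letter σ) s : ℕ)] = s := by simp [alphabet]
    have hd := within_decodeLetter (σ := σ) hi (m := (Coded.code w).word σ) (o := o)
    rw [hs] at hd
    exact (Within.step (n := 1 + 3 * (alphabet σ).length) rfl (Within.pop_main.seq hd) h).mono
      (by simp; ring_nf; rfl)

end Cmd

/-- The machine that runs a program and then resets its internal state. -/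
noncomputable def Cmd.machine (c : Prog σ) : Turing.FinTM2 where
  K := Reg
  k₀ := .aux
  k₁ := .out
  Γ _ := Letter σ
  Λ := Option c.Label
  main := some c.entry
  ΛFin := Fintype.ofFinite _
  σ := Option (Letter σ)
  initialState := none
  Γk₀Fin := inferInstanceAs (Fintype (Letter σ))
  m
    | none => .load (fun _ => none) .halt
    | some l => c.code some none l

theorem Cmd.initList_machine (c : Prog σ) (w : List (Letter σ)) :
    Turing.initList c.machine w = ⟨some (some c.entry), none, regs [] w [] []⟩ := by
  unfold Turing.initList
  congr 1
  funext k
  cases k <;> rfl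

theorem Cmd.haltList_machine (c : Prog σ) (w : List (Letter σ)) :
    Turing.haltList c.machine w = ⟨none, none, regs [] [] w []⟩ := by
  unfold Turing.haltList
  congr 1
  funext k
  cases k <;> rfl

/-- A function is computed in polynomial time by a machine if a program does so. -/
theorem polyTimeComputable_of_within {α β : Type} {ea : α → List (Letter σ)}
    {eb : β → List (Letter σ)} {f : α → β} (c : Prog σ) (p : ℕ[X])
    (h : ∀ a, c.Within (regs [] (ea a) [] []) (regs [] [] (eb (f a)) []) (p.eval (ea a).length)) :
    PolyTimeComputable ea eb f := by
  refine ⟨⟨⟨c.machine, .refl _, .refl _⟩, p + 1, fun a => Classical.choice ?_⟩⟩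
  obtain ⟨t, ht, hr⟩ := h a
  obtain ⟨v, hv⟩ := hr.iterate_step c.machine.m some none (fun _ => rfl) none
  refine ⟨⟨⟨t + 1, ?_⟩, by simpa using ht⟩⟩
  have h₀ : Turing.initList c.machine ((ea a).map (Equiv.refl (Letter σ)).invFun) =
      ⟨some (some c.entry), none, regs [] (ea a) [] []⟩ :=
    (congrArg (Turing.initList c.machine) (List.map_id (ea a))).trans (c.initList_machine _)
  have h₁ : Turing.haltList c.machine ((eb (f a)).map (Equiv.refl (Letter σ)).invFun) =
      ⟨none, none, regs [] [] (eb (f a)) []⟩ :=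
    (congrArg (Turing.haltList c.machine) (List.map_id (eb (f a)))).trans (c.haltList_machine _)
  have h₂ : (flip bind c.machine.step)^[t + 1] (some ⟨some (some c.entry), none,
      regs [] (ea a) [] []⟩) = some ⟨none, none, regs [] [] (eb (f a)) []⟩ := by
    rw [Function.iterate_succ_apply']
    exact (congrArg _ hv).trans rfl
  exact (congrArg (fun x => (flip bind c.machine.step)^[t + 1] (some x)) h₀).trans
    (h₂.trans (congrArg some h₁).symm)

end

theorem Program.polyTimeComputable_solve {σ : Schema} (P : Program σ) (K N : ℕ) :
    PolyTimeComputable encodeInput encodeOutput (P.solve K N) := by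
  obtain ⟨M, hM⟩ : ∃ M, ∀ s : Letter σ, sz s ≤ M :=
    ⟨Finset.univ.sup sz, fun s => Finset.le_sup (f := sz) (Finset.mem_univ s)⟩
  have hsz : ∀ w : List (Letter σ), sz w ≤ w.length * (M + 1) + 1 := by
    intro w
    induction w with
    | nil => simp
    | cons s w ih =>
      have := hM s
      simp only [sz_cons, List.length_cons, Nat.add_mul]
      omega
  obtain ⟨q, hq⟩ := (PT.parse (σ := σ)).sz_le
  obtain ⟨c, p, h⟩ := PT.parse (σ := σ)
  have hs := (PT.solve (P := P) K N).reverse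
  obtain ⟨q', hq'⟩ := hs.sz_le
  obtain ⟨c', p', h'⟩ := hs
  let B : ℕ[X] := X * (C M + 1) + 1
  let A := (Cmd.alphabet σ).length
  refine polyTimeComputable_of_within
    ((Cmd.readInput σ).seq (c.seq (c'.seq (Cmd.writeOutput σ))))
    (X * (C M + 5) + 2 +
      (p.comp B + (p'.comp (q.comp B) + (q'.comp (q.comp B) * (3 * C A + 2) + 2))))
    fun x => ?_
  have hB : sz (encodeInput x).reverse ≤ B.eval (encodeInput x).length := by
    simpa [B] using hsz (encodeInput x)
  have hx : sz x ≤ q.eval (B.eval (encodeInput x).length) := by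
    have := hq (encodeInput x).reverse
    rw [sz, code_parse] at this
    exact this.trans (eval_mono q hB)
  have h₁ := h (encodeInput x).reverse []
  have h₂ := h' x []
  rw [code_parse] at h₁
  simp only [List.append_nil] at h₁ h₂
  have h₃ := Cmd.within_writeOutput (encodeOutput (P.solve K N x)).reverse
  rw [List.reverse_reverse] at h₃
  refine ((Cmd.within_readInput hM _).seq (h₁.seq (h₂.seq h₃))).mono ?_
  have h₄ := eval_mono p hB
  have h₅ := eval_mono p' hx
  have h₆ : (encodeOutput (P.solve K N x)).reverse.length ≤
      q'.eval (q.eval (B.eval (encodeInput x).length)) :=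
    (length_lt_sz _).le.trans ((hq' x).trans (eval_mono q' hx))
  have h₇ := Nat.mul_le_mul_right (3 * A + 2) h₆
  simp only [eval_add, eval_mul, eval_comp, eval_X, eval_C, eval_ofNat] at h₄ h₅ h₇ ⊢
  simp only [A] at h₇ ⊢
  omega

end SPDatalog

theorem mainTheorem1 (σ : SPDatalog.Schema) (P : SPDatalog.Program σ) :
    ∃ f : List (SPDatalog.Fact σ) × (Fin P.arity → SPDatalog.Dom) →
        Option (List (SPDatalog.Fact σ) × List (SPDatalog.Fact σ)),
      SPDatalog.PolyTimeComputable SPDatalog.encodeInput SPDatalog.encodeOutput f ∧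
      ∀ (L : List (SPDatalog.Fact σ)) (a : Fin P.arity → SPDatalog.Dom),
        P.IsMAMinOutput L.toFinset a ((f (L, a)).map SPDatalog.Update.ofLists) := by
  obtain ⟨K, N, h⟩ := P.exists_solve_correct
  exact ⟨P.solve K N, P.polyTimeComputable_solve K N, h⟩
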